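/- **Setting.** Consider an explicit Runge–Kutta method with $s$ stages and real coefficients $a_{ij}$ ($j<i$), $b_i$, $c_i$, where $\sum_{j<i}a_{ij}=c_i$ for all $i$ (in particular $c_1=0$) and $c_i\in[0,1]$. Let $p\ge 1$, and let the method have conventional order $p$: for every $C^\infty$ function $f:\mathbb R^d\to\mathbb R^d$ and every solution $y$ of $y'=f(y)$ near $0$, its first step $y_1$ of size $h$ from $y(0)$ satisfies $y(h)-y_1=\mathcal O(h^{p+1})$ as $h\to0^+$. Let $X$ be a real Banach space (complex spaces are regarded as real ones), and let $A$ be a possibly unbounded linear operator on $X$ such that either * (group case) $-A$ generates a strongly continuous group with $\|e^{-tA}\|\le C_E$ for all $t\in\mathbb R$, or * (semigroup case) $-A$ generates a strongly continuous semigroup with $\|e^{-tA}\|\le C_E$ for all $t\ge 0$, and $0=c_1\le c_2\le\dots\le c_s\le 1$. Let $u\in C([0,T],X)$ be a (mild) solution of $u'+Au=g(u)$, i.e. $u(t)=e^{-tA}u(0)+\int_0^t e^{-(t-s)A}g(u(s))\,ds$ for $0\le t\le T$. Assume that on the neighbourhood $\{x:\ \|x-u(t)\|<r \text{ for some } t\in[0,T]\}$,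 $r>0$, the map $g:X\to X$ is $p$ times (real) Fréchet differentiable and its derivatives of order $0,\dots,p$ are bounded by $B$. The Lawson method with step size $\tau$ and $t_n=n\tau$ is $u_0=u(0)$, $$U_{ni}=e^{-c_i\tau A}u_n+\tau\sum_{j<i}a_{ij}e^{-(c_i-c_j)\tau A}g(U_{nj}),\qquad u_{n+1}=e^{-\tau A}u_n+\tau\sum_{i=1}^s b_ie^{-(1-c_i)\tau A}g(U_{ni}).$$ **Regularity condition.** For a rooted tree $\mathfrak t=[\mathfrak t_1,\dots,\mathfrak t_k]$ (a root with subtrees $\mathfrak t_1,\dots,\mathfrak t_k$, $k\ge0$) with $\varrho(\mathfrak t)$ nodes, attach a real variable to every node and define recursively $$\Psi_\zeta(\mathfrak t)(\sigma,\sigma_1,\dots,\sigma_k,w)=e^{-(\zeta-\sigma)\tau A}\,g^{(k)}\bigl(e^{-\sigma\tau A}w\bigr)\bigl(\Psi_\sigma(\mathfrak t_1)(\sigma_1,w),\dots,\Psi_\sigma(\mathfrak t_k)(\sigma_k,w)\bigr),$$ where $\sigma$ belongs to the root and $\sigma_j$ collects the variables of $\mathfrak t_j$; put $\Psi=\Psi_1$.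 Let $D_{\mathfrak t}=[0,1]^{\varrho(\mathfrak t)}$ in the group case; in the semigroup case let $D_{\mathfrak t}$ be the set of those points of $[0,1]^{\varrho(\mathfrak t)}$ at which the variable of each node is at most that of its parent (there only nonnegative times occur in $\Psi$). Assume that there are $\tau_{\max}>0$ and $K$ such that for all $\tau\in(0,\tau_{\max}]$, all $t$ with $0\le t$, $t+\tau\le T$, and all trees $\mathfrak t$ with $\varrho(\mathfrak t)\le p$, the function $\Psi(\mathfrak t)(\cdot,u(t))$ belongs to $C^{q,1}(D_{\mathfrak t},X)$, $q=p-\varrho(\mathfrak t)$, and its $q$-th derivative has Lipschitz constant $K\tau^{q+1}$ (that is, Lipschitz constant $K$ when $\Psi$ is regarded as a function of the rescaled variables $\tau\sigma_v$). **Theorem.** Then the Lawson method converges with order $p$: there are constants $\tau_0>0$ and $C$ such that $$\|u(t_n)-u_n\|\le C\tau^p\qquad\text{for all } 0<\tau\le\tau_0 \text{ and all } n\ge0 \text{ with } t_n=n\tau\le T.$$ The constants $C$ and $\tau_0$ do not depend on $n$, on $\tau$ or on the operator $A$: they depend only on the Runge–Kutta method, on $p$, on which of the two cases is considered, and on $C_E$,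 $B$, $r$, $T$, $K$, $\tau_{\max}$ (and so are also uniform in $X$, $g$ and $u$ with these data). -/

import Mathlib

open Set Filter Topology Asymptotics

noncomputable section

namespace Lawson

/-! ## Explicit Runge–Kutta methods -/

/-- The coefficients of an `s`-stage explicit Runge–Kutta method. Only the entries `a i j` with
`j < i` are ever used. The row sum condition includes `c 0 = 0` for the first stage. -/
structure ExplicitRK (s : ℕ) where
  a : Fin s → Fin s → ℝ
  b : Fin s → ℝ
  c : Fin s → ℝ
  row_sum : ∀ i, ∑ j : {j : Fin s // j < i}, a i j.1 = c i

/-- Internal stages `Y_i = y + h ∑_{j < i} a_{ij} f(Y_j)` for `y' = f(y)`. -/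
def ExplicitRK.stage {s : ℕ} (M : ExplicitRK s) {E : Type*} [AddCommGroup E] [Module ℝ E]
    (f : E → E) (h : ℝ) (y : E) (i : Fin s) : E :=
  y + h • ∑ j : {j : Fin s // j < i}, M.a i j.1 • f (M.stage f h y j.1)
termination_by i
decreasing_by exact j.2

/-- One step `y ↦ y + h ∑_i b_i f(Y_i)` of the Runge–Kutta method. -/
def ExplicitRK.step {s : ℕ} (M : ExplicitRK s) {E : Type*} [AddCommGroup E] [Module ℝ E]
    (f : E → E) (h : ℝ) (y : E) : E :=
  y + h • ∑ i, M.b i • f (M.stage f h y i)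

/-- Conventional (non-stiff) order (at least) `p`: for every smooth ordinary differential equation
`y' = f(y)` in `ℝ^d`, the local error is `O(h^{p+1})` as `h → 0+`. -/
def ExplicitRK.HasOrder {s : ℕ} (M : ExplicitRK s) (p : ℕ) : Prop :=
  ∀ (d : ℕ) (f : (Fin d → ℝ) → (Fin d → ℝ)) (y : ℝ → (Fin d → ℝ)),
    ContDiff ℝ (⊤ : ℕ∞) f →
    (∀ᶠ t in 𝓝 (0 : ℝ), HasDerivAt y (f (y t)) t) →
    (fun h : ℝ => y h - M.step f h (y 0)) =O[𝓝[>] 0] (fun h : ℝ => h ^ (p + 1))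

/-! ## Rooted trees -/

/-- Rooted trees, with the subtrees of a node listed in some order. The integrands below do not
depend on that order, up to renaming their variables. -/
inductive RTree : Type
  | node (k : ℕ) (child : Fin k → RTree) : RTree

namespace RTree

/-- The number of nodes. -/
def order : RTree → ℕ
  | node _ child => 1 + ∑ i, (child i).order

/-- The nodes of a tree: the root (`none`), and the nodes of the subtrees. -/
def Nodes : RTree → Type
  | node k child => Option (Σ i : Fin k, (child i).Nodes)

instance instFintypeNodes : (t : RTree) → Fintype t.Nodes
  | node k child =>
    letI : ∀ i, Fintype (child i).Nodes := fun i => instFintypeNodes (child i)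
    inferInstanceAs (Fintype (Option (Σ i : Fin k, (child i).Nodes)))

/-- The variable attached to the root. -/
def rootVar {k : ℕ} {child : Fin k → RTree} (σ : (node k child).Nodes → ℝ) : ℝ :=
  σ (none : Option (Σ i : Fin k, (child i).Nodes))

/-- The variables attached to the nodes of the `i`-th subtree. -/
def subVars {k : ℕ} {child : Fin k → RTree} (σ : (node k child).Nodes → ℝ) (i : Fin k) :
    (child i).Nodes → ℝ :=
  fun v => σ (some ⟨i, v⟩ : Option (Σ i : Fin k, (child i).Nodes))

/-- `0 ≤ σ_v ≤ ζ` for the root `v`, and `0 ≤ σ_w ≤ σ_v` for every child `w` of a node `v`. -/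
def IsOrdered : (t : RTree) → ℝ → (t.Nodes → ℝ) → Prop
  | node _ child, ζ, σ =>
    0 ≤ rootVar σ ∧ rootVar σ ≤ ζ ∧ ∀ i, (child i).IsOrdered (rootVar σ) (subVars σ i)

end RTree

/-! ## Operator groups and semigroups -/

/-- The two settings: `-A` generates a bounded group, or only a bounded semigroup. -/
inductive Setting : Type
  | group
  | semigroup

/-- The times `t` at which `e^{-tA}` is available. -/
def Setting.times : Setting → Set ℝ
  | group => univ
  | semigroup => Ici 0

/-- The nodes lie in `[0,1]`; in the semigroup setting they are moreover non-decreasing. -/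
def Setting.NodesAdmissible {s : ℕ} (m : Setting) (M : ExplicitRK s) : Prop :=
  (∀ i, M.c i ∈ Icc (0 : ℝ) 1) ∧
    match m with
    | group => True
    | semigroup => Monotone M.c

/-- The domain of the integrand of a tree: the whole cube `[0,1]^{Nodes}` for groups, and
that part of it in which no negative times occur for semigroups. -/
def Setting.domain (m : Setting) (t : RTree) : Set (t.Nodes → ℝ) :=
  match m with
  | group => {σ | ∀ v, σ v ∈ Icc (0 : ℝ) 1}
  | semigroup => {σ | t.IsOrdered 1 σ}

variable {X : Type*} [NormedAddCommGroup X] [NormedSpace ℝ X]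

/-- `-A` generates the strongly continuous group (or semigroup) `S t = e^{-tA}`, and
`‖e^{-tA}‖ ≤ CE` for all `t` in `ℝ` (or for all `t ≥ 0`). The operator `A` may be unbounded.
In the semigroup setting the values `S t` with `t < 0` are irrelevant. -/
structure IsBoundedFlow (m : Setting) (A : X →ₗ.[ℝ] X) (S : ℝ → X →L[ℝ] X) (CE : ℝ) : Prop where
  map_zero : S 0 = ContinuousLinearMap.id ℝ X
  map_add : ∀ s ∈ m.times, ∀ t ∈ m.times, S (s + t) = (S s).comp (S t)
  continuousOn : ∀ x, ContinuousOn (fun t => S t x) m.times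
  generator : ∀ x y, (x, y) ∈ A.graph ↔
    Tendsto (fun t : ℝ => t⁻¹ • (S t x - x)) (𝓝[>] 0) (𝓝 (-y))
  bound : ∀ t ∈ m.times, ‖S t‖ ≤ CE

/-- `u` is a (mild) solution of `u' + A u = g(u)` on `[0,T]`, where `S t = e^{-tA}`. -/
structure IsSolution (S : ℝ → X →L[ℝ] X) (g : X → X) (u : ℝ → X) (T : ℝ) : Prop where
  continuousOn : ContinuousOn u (Icc 0 T)
  eq : ∀ t ∈ Icc 0 T, u t = S t (u 0) + ∫ s in (0 : ℝ)..t, S (t - s) (g (u s))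

/-- `g` is `p` times differentiable on the open set `V`, and its derivatives of order
`0, …, p` are bounded by `B` there. -/
structure HasBoundedDerivs (g : X → X) (V : Set X) (p : ℕ) (B : ℝ) : Prop where
  differentiableOn : ∀ k < p, DifferentiableOn ℝ (iteratedFDeriv ℝ k g) V
  bound : ∀ k ≤ p, ∀ x ∈ V, ‖iteratedFDeriv ℝ k g x‖ ≤ B

/-! ## Lawson methods -/

/-- Internal stages
`U_i = e^{-c_i τ A} x + τ ∑_{j < i} a_{ij} e^{-(c_i - c_j) τ A} g(U_j)`. -/
def stage {s : ℕ} (M : ExplicitRK s) (S : ℝ → X →L[ℝ] X) (g : X → X) (τ : ℝ) (x : X)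
    (i : Fin s) : X :=
  S (M.c i * τ) x +
    τ • ∑ j : {j : Fin s // j < i},
      M.a i j.1 • S ((M.c i - M.c j.1) * τ) (g (stage M S g τ x j.1))
termination_by i
decreasing_by exact j.2

/-- One step `x ↦ e^{-τA} x + τ ∑_i b_i e^{-(1 - c_i) τ A} g(U_i)` of the Lawson method. -/
def step {s : ℕ} (M : ExplicitRK s) (S : ℝ → X →L[ℝ] X) (g : X → X) (τ : ℝ) (x : X) : X :=
  S τ x + τ • ∑ i, M.b i • S ((1 - M.c i) * τ) (g (stage M S g τ x i))

/-- The numerical solution `u_n` with initial value `u₀`. -/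
def numSol {s : ℕ} (M : ExplicitRK s) (S : ℝ → X →L[ℝ] X) (g : X → X) (τ : ℝ) (u₀ : X) :
    ℕ → X
  | 0 => u₀
  | n + 1 => step M S g τ (numSol M S g τ u₀ n)

/-! ## The regularity condition -/

/-- The integrand `Ψ_ζ` of the elementary integral of a tree: for a root with variable `σ` and
with subtrees `t_1, …, t_k`, it is
`e^{-(ζ-σ)τA} g^{(k)}(e^{-στA} w) (Ψ_σ(t_1), …, Ψ_σ(t_k))`. -/
def integrand (S : ℝ → X →L[ℝ] X) (g : X → X) (τ : ℝ) (w : X) :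
    (t : RTree) → ℝ → (t.Nodes → ℝ) → X
  | .node k child, ζ, σ =>
    S ((ζ - RTree.rootVar σ) * τ)
      (iteratedFDeriv ℝ k g (S (RTree.rootVar σ * τ) w)
        (fun i => integrand S g τ w (child i) (RTree.rootVar σ) (RTree.subVars σ i)))

/-- For every tree `t` with at most `p` nodes, `Ψ_1(t)(·, u(t₀))` is of class `C^{q,1}` with
`q = p - order t`, uniformly along the solution: with respect to the variables `τσ_v`, the `q`-th
derivative has Lipschitz constant `K`, that is `K τ^{q+1}` with respect to the variables `σ_v`. -/
def IsRegular (m : Setting) (S : ℝ → X →L[ℝ] X) (g : X → X) (u : ℝ → X) (T : ℝ) (p : ℕ)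
    (τmax K : ℝ) : Prop :=
  ∀ τ t₀ : ℝ, 0 < τ → τ ≤ τmax → 0 ≤ t₀ → t₀ + τ ≤ T →
    ∀ t : RTree, t.order ≤ p →
      ContDiffOn ℝ ((p - t.order : ℕ) : WithTop ℕ∞) (integrand S g τ (u t₀) t 1) (m.domain t) ∧
      ∀ σ ∈ m.domain t, ∀ σ' ∈ m.domain t,
        ‖iteratedFDerivWithin ℝ (p - t.order) (integrand S g τ (u t₀) t 1) (m.domain t) σ -
          iteratedFDerivWithin ℝ (p - t.order) (integrand S g τ (u t₀) t 1) (m.domain t) σ'‖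
        ≤ K * τ ^ (p - t.order + 1) * ‖σ - σ'‖

end Lawson

end

/-! The exact solution is itself a limit of Lawson methods. Indeed, `N` exponential Euler steps of
length `τ / N` are one step of the `N`-stage method `euler N`, and `u (t₀ + τ)` is the limit of
these steps (`tendsto_step_euler`). The local error is thus the limit of differences of two Lawson
steps from the same point, and neither derivatives of `u` nor iterated integrals in `X` are needed.

Picard iteration for the stages, with `g` replaced by its Taylor polynomial of degree `p - 1`,
expands a step up to `O(τ^(p+1))` into a finite sum over trees of `τ ^ order` times a nested
quadrature formula applied to the integrand of the tree. The trees and their scalar coefficients are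
the same for all methods (`exists_expand_eq_sum_treeQuad`), so two methods can be compared tree by
tree. A tree with more than `p` nodes already has enough powers of `τ`. For the others the integrand
is Taylor expanded at the corner `0` of its domain to degree `q = p - order`; by the regularity
condition the remainder is at most `K τ^(q+1)`. On the Taylor polynomial the formula depends only on
the moments of the tableau of degree at most `q` (`norm_sum_weight_sub_le`).

These moments are the exact monomial integrals if the method has order `p`: applied to a polynomial
system attached to a tree and to exponents, a Runge–Kutta step makes an error which is exactly the
defect of the moment times a power of `h` (`ExplicitRK.HasOrder.moment_eq`). The moments of `euler
N` converge to the same values (`tendsto_euler_moment`). In the limit the two polynomial parts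
cancel, and the local error is `O(τ^(p+1))` (`exists_norm_local_error_le`).

Since `CE` may exceed one, iterating an error bound step by step would produce `CE ^ n`. Instead `S
(k * τ)` applied to the error is estimated for all `k` at once, followed by a discrete Gronwall
argument (`IsProblem.norm_flow_global_error_le`). -/

noncomputable section

namespace Lawson

/-! ### Families indexed by the nodes of a tree -/

namespace RTree

/-- The root. -/
def root : (t : RTree) → t.Nodes
  | node k child => (none : Option (Σ i : Fin k, (child i).Nodes))

/-- A node of the `i`-th subtree, as a node of the whole tree. -/
def sub {k : ℕ} {child : Fin k → RTree} (i : Fin k) (v : (child i).Nodes) :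
    (node k child).Nodes :=
  (some ⟨i, v⟩ : Option (Σ i : Fin k, (child i).Nodes))

/-- A family indexed by the nodes of a tree consists of a value at the root and of families indexed
by the nodes of the subtrees. -/
def nodesArrowEquiv {k : ℕ} (child : Fin k → RTree) (α : Type*) :
    ((node k child).Nodes → α) ≃ α × ((i : Fin k) → (child i).Nodes → α) where
  toFun a := (a (root _), fun i v => a (sub i v))
  invFun q := fun v =>
    match (v : Option (Σ i : Fin k, (child i).Nodes)) with
    | none => q.1
    | some v => q.2 v.1 v.2
  left_inv a := by
    funext v
    match (v : Option (Σ i : Fin k, (child i).Nodes)) with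
    | none => rfl
    | some ⟨i, v⟩ => rfl
  right_inv q := rfl

theorem prod_nodes {k : ℕ} {child : Fin k → RTree} {β : Type*} [CommMonoid β]
    (F : (node k child).Nodes → β) :
    ∏ v, F v = F (root _) * ∏ i, ∏ v, F (sub i v) := by
  have key : ∀ G : Option (Σ i : Fin k, (child i).Nodes) → β,
      ∏ v, G v = G none * ∏ i, ∏ v, G (some ⟨i, v⟩) := by
    intro G
    rw [Fintype.prod_option, Fintype.prod_sigma]
  exact key F

theorem sum_nodes {k : ℕ} {child : Fin k → RTree} {β : Type*} [AddCommMonoid β]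
    (F : (node k child).Nodes → β) :
    ∑ v, F v = F (root _) + ∑ i, ∑ v, F (sub i v) := by
  have key : ∀ G : Option (Σ i : Fin k, (child i).Nodes) → β,
      ∑ v, G v = G none + ∑ i, ∑ v, G (some ⟨i, v⟩) := by
    intro G
    rw [Fintype.sum_option, Fintype.sum_sigma]
  exact key F

open Classical in
theorem sum_nodesArrow {k : ℕ} {child : Fin k → RTree} {α β : Type*} [Fintype α]
    [AddCommMonoid β] (F : α → ((i : Fin k) → (child i).Nodes → α) → β) :
    ∑ a : (node k child).Nodes → α, F (a (root _)) (fun i v => a (sub i v)) =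
      ∑ j, ∑ b : (i : Fin k) → (child i).Nodes → α, F j b := by
  rw [← Fintype.sum_prod_type' F]
  exact Fintype.sum_equiv (nodesArrowEquiv child α) _ _ fun a => rfl

end RTree

open RTree

/-! ### Nested quadrature formulas and their moments -/

variable {s : ℕ}

/-- The weight of an assignment of quadrature nodes to the nodes of a tree: the product of the
coefficients along the edges, with the weights `r` for the root. -/
def weight (L : Fin s → Fin s → ℝ) : (t : RTree) → (Fin s → ℝ) → (t.Nodes → Fin s) → ℝ
  | .node k child, r, a =>
    r (a (root (.node k child))) *
      ∏ i, weight L (child i) (L (a (root (.node k child)))) (fun v => a (sub i v))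

/-- The nested quadrature formula of a tree, applied to the monomial with exponents `d`. -/
def moment (L : Fin s → Fin s → ℝ) (c : Fin s → ℝ) :
    (t : RTree) → (t.Nodes → ℕ) → (Fin s → ℝ) → ℝ
  | .node k child, d, r =>
    ∑ j, r j * (c j ^ d (root (.node k child)) *
      ∏ i, moment L c (child i) (fun v => d (sub i v)) (L j))

-- Distributing the products over the subtrees turns the nested sums into a single sum over all
-- assignments of quadrature nodes.
open Classical in
theorem moment_eq_sum (L : Fin s → Fin s → ℝ) (c : Fin s → ℝ) (t : RTree) (d : t.Nodes → ℕ)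
    (r : Fin s → ℝ) :
    moment L c t d r = ∑ a : t.Nodes → Fin s, weight L t r a * ∏ v, c (a v) ^ d v := by
  induction t generalizing r with
  | node k child ih =>
    simp only [moment, weight, prod_nodes]
    rw [sum_nodesArrow (fun j b => r j * (∏ i, weight L (child i) (L j) (b i)) *
      (c j ^ d (root _) * ∏ i, ∏ v, c (b i v) ^ d (sub i v)))]
    refine Finset.sum_congr rfl fun j _ => ?_
    simp only [ih]
    rw [Finset.prod_univ_sum, Fintype.piFinset_univ, Finset.mul_sum, Finset.mul_sum]
    refine Finset.sum_congr rfl fun b _ => ?_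
    rw [Finset.prod_mul_distrib]
    ring

/-- The value of `∫ ∏ σ_v ^ d_v` over `0 ≤ σ_w ≤ σ_v ≤ 1` (for all nodes `v` and children `w`). -/
def exactMoment : (t : RTree) → (t.Nodes → ℕ) → ℝ
  | .node k child, d =>
    (∏ i, exactMoment (child i) (fun v => d (sub i v))) /
      ((RTree.node k child).order + ∑ v, d v : ℕ)

theorem order_node {k : ℕ} (child : Fin k → RTree) :
    (RTree.node k child).order = 1 + ∑ i, (child i).order := rfl

/-- The summand one comes from integrating over the root variable, which raises the degree of the
monomial by one. -/
theorem degree_node {k : ℕ} {child : Fin k → RTree} (d : (RTree.node k child).Nodes → ℕ) :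
    (RTree.node k child).order + ∑ v, d v =
      d (root _) + ∑ i, ((child i).order + ∑ v, d (sub i v)) + 1 := by
  rw [order_node, sum_nodes, Finset.sum_add_distrib]; ring

/-- The entries of the tableau below the diagonal. -/
def ExplicitRK.lower (M : ExplicitRK s) (i j : Fin s) : ℝ := if j < i then M.a i j else 0

theorem ExplicitRK.sum_lower {E : Type*} [AddCommGroup E] [Module ℝ E] (M : ExplicitRK s)
    (i : Fin s) (F : Fin s → E) :
    ∑ j : {j : Fin s // j < i}, M.a i j.1 • F j.1 = ∑ j, M.lower i j • F j := by
  have h : ∀ j, M.lower i j • F j = if j < i then M.a i j • F j else 0 := by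
    intro j; unfold ExplicitRK.lower; split_ifs <;> simp
  simp only [h, ← Finset.sum_filter]
  exact (Finset.sum_subtype _ (by simp) (fun j => M.a i j • F j)).symm

theorem ExplicitRK.sum_lower_eq (M : ExplicitRK s) (i : Fin s) : ∑ j, M.lower i j = M.c i := by
  rw [← M.row_sum i]
  simpa using (M.sum_lower i (fun _ => (1 : ℝ))).symm

/-! ### Order conditions, obtained from polynomial test systems -/

theorem ExplicitRK.stage_eq {E : Type*} [AddCommGroup E] [Module ℝ E] (M : ExplicitRK s)
    (f : E → E) (h : ℝ) (y : E) (i : Fin s) :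
    M.stage f h y i = y + h • ∑ j, M.lower i j • f (M.stage f h y j) := by
  rw [ExplicitRK.stage, M.sum_lower i (fun j => f (M.stage f h y j))]

theorem ExplicitRK.stage_conj {E F : Type*} [AddCommGroup E] [Module ℝ E] [AddCommGroup F]
    [Module ℝ F] (M : ExplicitRK s) (e : E ≃ₗ[ℝ] F) (f : E → E) (h : ℝ) (y : E) (i : Fin s) :
    M.stage (fun x => e (f (e.symm x))) h (e y) i = e (M.stage f h y i) := by
  induction i using WellFoundedLT.induction with
  | _ i ih =>
    rw [ExplicitRK.stage, ExplicitRK.stage]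
    simp only [map_add, map_smul, map_sum]
    congr 2
    refine Finset.sum_congr rfl fun j _ => ?_
    rw [ih j.1 j.2, e.symm_apply_apply]

theorem ExplicitRK.step_conj {E F : Type*} [AddCommGroup E] [Module ℝ E] [AddCommGroup F]
    [Module ℝ F] (M : ExplicitRK s) (e : E ≃ₗ[ℝ] F) (f : E → E) (h : ℝ) (y : E) :
    M.step (fun x => e (f (e.symm x))) h (e y) = e (M.step f h y) := by
  simp only [ExplicitRK.step, M.stage_conj, map_add, map_smul, map_sum, e.symm_apply_apply]

/-- A Runge–Kutta step commutes with linear changes of coordinates, so the order, defined on `Fin d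
→ ℝ`, is available on the space of the test system below. -/
theorem ExplicitRK.HasOrder.isBigO {M : ExplicitRK s} {p : ℕ} (hM : M.HasOrder p) {E : Type*}
    [NormedAddCommGroup E] [NormedSpace ℝ E] [FiniteDimensional ℝ E] {f : E → E} {y : ℝ → E}
    (hf : ContDiff ℝ (⊤ : ℕ∞) f) (hy : ∀ᶠ t in 𝓝 (0 : ℝ), HasDerivAt y (f (y t)) t) :
    (fun h : ℝ => y h - M.step f h (y 0)) =O[𝓝[>] 0] (fun h : ℝ => h ^ (p + 1)) := by
  have e : E ≃L[ℝ] (Fin (Module.finrank ℝ E) → ℝ) := ContinuousLinearEquiv.ofFinrankEq (by simp)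
  have h := hM _ (fun x => e (f (e.symm x))) (fun t => e (y t))
    (e.contDiff.comp (hf.comp e.symm.contDiff))
    (hy.mono fun t ht => by
      simp only [e.symm_apply_apply]
      exact e.hasFDerivAt.comp_hasDerivAt t ht)
  have h2 : ∀ h, e (y h) - M.step (fun x => e (f (e.symm x))) h (e (y 0)) =
      e (y h - M.step f h (y 0)) := by
    intro h
    rw [map_sub]
    congr 1
    exact M.step_conj e.toLinearEquiv f h (y 0)
  simp only [h2] at h
  have h3 := ((e.symm : _ →L[ℝ] E).isBigO_comp
    (fun h => e (y h - M.step f h (y 0))) (𝓝[>] (0 : ℝ)))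
  simpa using h3.trans h

/-- The vector field of the system `y_v' = x ^ d_v * ∏ y_w`, with the product taken over the
children `w` of `v`. -/
def treeField : (t : RTree) → (t.Nodes → ℕ) → ℝ → (t.Nodes → ℝ) → (t.Nodes → ℝ)
  | .node k child, d, x, y => (nodesArrowEquiv child ℝ).symm
    (x ^ d (root (.node k child)) * ∏ i, y (sub i (root (child i))),
      fun i => treeField (child i) (fun v => d (sub i v)) x (fun v => y (sub i v)))

/-- The solution of the system with vector field `treeField` and with value `0` at `0`. -/
def treeSolution : (t : RTree) → (t.Nodes → ℕ) → ℝ → (t.Nodes → ℝ)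
  | .node k child, d, x => (nodesArrowEquiv child ℝ).symm
    (exactMoment (.node k child) d * x ^ ((RTree.node k child).order + ∑ v, d v),
      fun i => treeSolution (child i) (fun v => d (sub i v)) x)

theorem treeSolution_root (t : RTree) (d : t.Nodes → ℕ) (x : ℝ) :
    treeSolution t d x t.root = exactMoment t d * x ^ (t.order + ∑ v, d v) := by
  cases t; rfl

theorem treeSolution_zero (t : RTree) (d : t.Nodes → ℕ) : treeSolution t d 0 = 0 := by
  induction t with
  | node k child ih =>
    funext v
    match (v : Option (Σ i : Fin k, (child i).Nodes)) with
    | none =>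
      exact (treeSolution_root (.node k child) d 0).trans
        (show _ = (0 : ℝ) by rw [degree_node]; simp)
    | some ⟨i, v⟩ => exact congrFun (ih i _) v

/-- The components at the children are monomials, so the right-hand side at the root is one as well;
integrating it divides by the total degree, as in the recursion for `exactMoment`. -/
theorem hasDerivAt_treeSolution (t : RTree) (d : t.Nodes → ℕ) (x : ℝ) :
    HasDerivAt (treeSolution t d) (treeField t d x (treeSolution t d x)) x := by
  rw [hasDerivAt_pi]
  induction t with
  | node k child ih =>
    intro v
    match (v : Option (Σ i : Fin k, (child i).Nodes)) with
    | none =>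
      have h1 : HasDerivAt (fun x : ℝ => exactMoment (.node k child) d *
          x ^ ((RTree.node k child).order + ∑ v, d v))
          (exactMoment (.node k child) d * (((RTree.node k child).order + ∑ v, d v : ℕ) *
            x ^ ((RTree.node k child).order + ∑ v, d v - 1))) x :=
        (hasDerivAt_pow _ x).const_mul _
      refine h1.congr_deriv ?_
      change _ = x ^ d (root (.node k child)) *
        ∏ i, treeSolution (child i) (fun v => d (sub i v)) x (root (child i))
      simp only [treeSolution_root, Finset.prod_mul_distrib, Finset.prod_pow_eq_pow_sum]
      have h0 : (((RTree.node k child).order + ∑ v, d v : ℕ) : ℝ) ≠ 0 := by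
        rw [degree_node]; positivity
      rw [exactMoment, ← mul_assoc, div_mul_cancel₀ _ h0, degree_node, Nat.add_sub_cancel, pow_add]
      ring
    | some ⟨i, v⟩ => exact ih i (fun v => d (sub i v)) v

theorem contDiff_treeField (t : RTree) (d : t.Nodes → ℕ) :
    ContDiff ℝ (⊤ : ℕ∞) (fun z : ℝ × (t.Nodes → ℝ) => treeField t d z.1 z.2) := by
  rw [contDiff_pi]
  induction t with
  | node k child ih =>
    intro v
    match (v : Option (Σ i : Fin k, (child i).Nodes)) with
    | none =>
      change ContDiff ℝ (⊤ : ℕ∞) (fun z : ℝ × ((RTree.node k child).Nodes → ℝ) =>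
        z.1 ^ d (root (.node k child)) * ∏ i, z.2 (sub i (root (child i))))
      refine (contDiff_fst.pow _).mul (contDiff_prod fun i _ => ?_)
      exact (contDiff_apply ℝ ℝ _).comp contDiff_snd
    | some ⟨i, v⟩ =>
      refine (ih i (fun v => d (sub i v)) v).comp
        (contDiff_fst.prodMk (contDiff_pi.2 fun w => ?_))
      exact (contDiff_apply ℝ ℝ _).comp contDiff_snd

/-- Hypothesis `hY` is the stage equation of the test system with initial value zero. The weights
`r` are arbitrary because the induction applies the claim to the subtrees with the rows `L j`,
whereas the step itself needs the weights `b`. -/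
theorem root_eq_moment (L : Fin s → Fin s → ℝ) (c : Fin s → ℝ) (h : ℝ) (t : RTree)
    (d : t.Nodes → ℕ) (Y : Fin s → t.Nodes → ℝ)
    (hY : ∀ i v, Y i v = h * ∑ j, L i j * treeField t d (c j * h) (Y j) v)
    (r : Fin s → ℝ) :
    h * ∑ j, r j * treeField t d (c j * h) (Y j) t.root =
      h ^ (t.order + ∑ v, d v) * moment L c t d r := by
  induction t generalizing r with
  | node k child ih =>
    have h1 : ∀ j i, Y j (sub i (root (child i))) =
        h ^ ((child i).order + ∑ v, d (sub i v)) *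
          moment L c (child i) (fun v => d (sub i v)) (L j) := by
      intro j i
      rw [← ih i (fun v => d (sub i v)) (fun j v => Y j (sub i v))
        (fun j v => hY j (sub i v)) (L j)]
      exact hY j (sub i (root (child i)))
    have h2 : ∀ j, treeField (.node k child) d (c j * h) (Y j) (root _) =
      (c j * h) ^ d (root (.node k child)) * ∏ i, Y j (sub i (root (child i))) := fun j => rfl
    simp only [h2, h1, moment, Finset.prod_mul_distrib, Finset.prod_pow_eq_pow_sum]
    rw [degree_node, Finset.mul_sum, Finset.mul_sum]
    refine Finset.sum_congr rfl fun j _ => ?_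
    rw [pow_succ, pow_add, mul_pow]
    ring

/-- For the test system the error at the root is exactly a constant times `h ^ n` with `n ≤ p`. It
can be `O(h^(p+1))` only if the constant vanishes. -/
theorem ExplicitRK.HasOrder.moment_eq {M : ExplicitRK s} {p : ℕ} (hM : M.HasOrder p) (t : RTree)
    (d : t.Nodes → ℕ) (hd : t.order + ∑ v, d v ≤ p) :
    moment M.lower M.c t d M.b = exactMoment t d := by
  set n := t.order + ∑ v, d v with hn
  -- The independent variable becomes a component with derivative one, which makes the system
  -- autonomous; by the row sums its stage values are `c i * h`.
  let f : ℝ × (t.Nodes → ℝ) → ℝ × (t.Nodes → ℝ) := fun z => (1, treeField t d z.1 z.2)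
  let y : ℝ → ℝ × (t.Nodes → ℝ) := fun x => (x, treeSolution t d x)
  have hO := hM.isBigO (f := f) (y := y) (contDiff_const.prodMk (contDiff_treeField t d))
    (Eventually.of_forall fun x => (hasDerivAt_id x).prodMk (hasDerivAt_treeSolution t d x))
  have hy0 : y 0 = 0 := by simp [y, treeSolution_zero]
  have hf1 : ∀ z, (f z).1 = 1 := fun z => rfl
  have hf2 : ∀ z, (f z).2 = treeField t d z.1 z.2 := fun z => rfl
  have hst1 : ∀ h i, (M.stage f h (y 0) i).1 = M.c i * h := by
    intro h i
    rw [M.stage_eq, hy0]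
    simp [hf1, Prod.fst_sum, M.sum_lower_eq, mul_comm]
  have hst2 : ∀ h i v, (M.stage f h (y 0) i).2 v =
      h * ∑ j, M.lower i j * treeField t d (M.c j * h) (M.stage f h (y 0) j).2 v := by
    intro h i v
    rw [M.stage_eq]
    simp only [hy0, zero_add, Prod.smul_snd, Prod.snd_sum, hf2, Pi.smul_apply, Finset.sum_apply,
      smul_eq_mul]
    simp only [← hy0, hst1]
  have hstep : ∀ h, (y h - M.step f h (y 0)).2 t.root =
      (exactMoment t d - moment M.lower M.c t d M.b) * h ^ n := by
    intro h
    have h1 := root_eq_moment M.lower M.c h t d (fun i => (M.stage f h (y 0) i).2) (hst2 h) M.b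
    have h2 : (M.step f h (y 0)).2 t.root =
        h * ∑ j, M.b j * treeField t d (M.c j * h) (M.stage f h (y 0) j).2 t.root := by
      rw [ExplicitRK.step, hy0]
      simp only [zero_add, Prod.smul_snd, Prod.snd_sum, hf2, Pi.smul_apply, Finset.sum_apply,
        smul_eq_mul]
      simp only [← hy0, hst1]
    have h3 : (y h).2 t.root = exactMoment t d * h ^ n := treeSolution_root t d h
    rw [Prod.snd_sub, Pi.sub_apply, h2, h1, h3, ← hn]
    ring
  have hO2 : (fun h : ℝ => (exactMoment t d - moment M.lower M.c t d M.b) * h ^ n)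
      =O[𝓝[>] 0] (fun h : ℝ => h ^ (p + 1)) := by
    refine IsBigO.trans (IsBigO.of_bound 1 (Eventually.of_forall fun h => ?_)) hO
    rw [← hstep, one_mul]
    exact (norm_le_pi_norm _ _).trans (norm_snd_le _)
  by_contra hne
  have hne' : exactMoment t d - moment M.lower M.c t d M.b ≠ 0 := sub_ne_zero.2 (Ne.symm hne)
  have hO3 : (fun h : ℝ => h ^ n) =O[𝓝[>] 0] (fun h : ℝ => h ^ (p + 1)) :=
    (isBigO_const_mul_left_iff hne').1 hO2
  have ho : (fun h : ℝ => h ^ (p + 1)) =o[𝓝[>] 0] (fun h : ℝ => h ^ n) :=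
    (isLittleO_pow_pow (by omega)).mono nhdsWithin_le_nhds
  have := hO3.trans_isLittleO ho
  refine isLittleO_irrefl ?_ this
  refine Eventually.frequently ?_
  filter_upwards [self_mem_nhdsWithin] with h hh using (pow_pos hh n).ne'

end Lawson

namespace Lawson
open RTree

/-! ## Taylor expansions -/

/-- The derivative of the remainder is the remainder of the shifted family `φ (k + 1)`, so the mean
value inequality gives an induction. The free top coefficient `a` covers two uses: `a = φ n 0` for a
Lipschitz top derivative, and `a = 0` for a merely bounded one. -/
theorem norm_taylor_remainder_le {E : Type*} [NormedAddCommGroup E] [NormedSpace ℝ E] {n : ℕ}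
    {φ : ℕ → ℝ → E} {a : E} {C : ℝ}
    (hφ : ∀ k < n, ∀ s ∈ Icc (0 : ℝ) 1, HasDerivWithinAt (φ k) (φ (k + 1) s) (Icc 0 1) s)
    (hn : ∀ s ∈ Icc (0 : ℝ) 1, ‖φ n s - a‖ ≤ C) (s : ℝ) (hs : s ∈ Icc (0 : ℝ) 1) :
    ‖φ 0 s - ∑ k ∈ Finset.range n, (s ^ k / k.factorial) • φ k 0 - (s ^ n / n.factorial) • a‖
      ≤ C := by
  induction n generalizing φ s with
  | zero => simpa using hn s hs
  | succ n ih =>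
    have h1 := ih (φ := fun k => φ (k + 1)) (fun k hk => hφ (k + 1) (by omega)) hn
    have hC : 0 ≤ C := (norm_nonneg _).trans (hn s hs)
    have hpow : ∀ (k : ℕ) (s : ℝ), HasDerivAt (fun s : ℝ => s ^ (k + 1) / (k + 1).factorial)
        (s ^ k / k.factorial) s := by
      intro k s
      refine ((hasDerivAt_pow (k + 1) s).div_const _).congr_deriv ?_
      rw [Nat.factorial_succ]
      push_cast
      field_simp
    have hd : ∀ x ∈ Icc (0 : ℝ) 1, HasDerivWithinAt
        (fun s => φ 0 s - ∑ k ∈ Finset.range (n + 1), (s ^ k / k.factorial) • φ k 0 -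
          (s ^ (n + 1) / (n + 1).factorial) • a)
        (φ 1 x - ∑ k ∈ Finset.range n, (x ^ k / k.factorial) • φ (k + 1) 0 -
          (x ^ n / n.factorial) • a) (Icc 0 1) x := by
      intro x hx
      simp only [Finset.sum_range_succ']
      refine HasDerivWithinAt.sub (HasDerivWithinAt.sub (hφ 0 (by omega) x hx) ?_)
        ((hpow n x).hasDerivWithinAt.smul_const a)
      simp only [pow_zero, Nat.factorial_zero, Nat.cast_one, div_one, one_smul]
      refine HasDerivWithinAt.add_const _ ?_
      exact HasDerivWithinAt.fun_sum fun k _ => (hpow k x).hasDerivWithinAt.smul_const _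
    have h2 := (convex_Icc (0 : ℝ) 1).norm_image_sub_le_of_norm_hasDerivWithin_le hd
      (fun x hx => h1 x hx) (left_mem_Icc.2 zero_le_one) hs
    have h3 : φ 0 0 - ∑ k ∈ Finset.range (n + 1), ((0 : ℝ) ^ k / k.factorial) • φ k 0 -
          ((0 : ℝ) ^ (n + 1) / (n + 1).factorial) • a = 0 := by
      simp [Finset.sum_range_succ']
    rw [h3, sub_zero, sub_zero, Real.norm_eq_abs, abs_of_nonneg hs.1] at h2
    exact h2.trans (mul_le_of_le_one_right hC hs.2)

variable {E F : Type*} [NormedAddCommGroup E] [NormedSpace ℝ E] [NormedAddCommGroup F]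
  [NormedSpace ℝ F]

theorem hasDerivWithinAt_multilinear_apply_const {k : ℕ} {ψ : E → E [×k]→L[ℝ] F} {D : Set E}
    {ψ' : E →L[ℝ] E [×k]→L[ℝ] F} {x v : E} {s : ℝ} (hψ : HasFDerivWithinAt ψ ψ' D (x + s • v))
    (hD : MapsTo (fun s : ℝ => x + s • v) (Icc 0 1) D) :
    HasDerivWithinAt (fun s : ℝ => ψ (x + s • v) fun _ => v) (ψ' v fun _ => v) (Icc 0 1) s := by
  have h1 : HasDerivWithinAt (fun s : ℝ => x + s • v) v (Icc 0 1) s := by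
    simpa using ((hasDerivWithinAt_id s (Icc (0 : ℝ) 1)).smul_const v).const_add x
  have h2 := hψ.comp_hasDerivWithinAt s h1 hD
  exact (ContinuousMultilinearMap.apply ℝ (fun _ : Fin k => E) F
    fun _ => v).hasFDerivAt.comp_hasDerivWithinAt s h2

/-- Restriction to the segment from `x` to `y`, which lies in `D` by convexity. Only the oscillation
of the `q`-th derivative about `x` enters. -/
theorem norm_sub_taylor_within_le {D : Set E} (hD : Convex ℝ D) (hu : UniqueDiffOn ℝ D)
    {f : E → F} {q : ℕ} (hf : ContDiffOn ℝ q f D) {C : ℝ} {x y : E} (hx : x ∈ D) (hy : y ∈ D)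
    (hC : ∀ z ∈ D, ‖iteratedFDerivWithin ℝ q f D z - iteratedFDerivWithin ℝ q f D x‖ ≤ C) :
    ‖f y - ∑ k ∈ Finset.range (q + 1),
      ((k.factorial : ℝ)⁻¹) • iteratedFDerivWithin ℝ k f D x (fun _ => y - x)‖
      ≤ C * ‖y - x‖ ^ q := by
  have hmaps : MapsTo (fun s : ℝ => x + s • (y - x)) (Icc 0 1) D := fun s hs =>
    hD.add_smul_sub_mem hx hy hs
  have h := norm_taylor_remainder_le (n := q) (C := C * ‖y - x‖ ^ q)
    (φ := fun k s => iteratedFDerivWithin ℝ k f D (x + s • (y - x)) fun _ => y - x)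
    (a := iteratedFDerivWithin ℝ q f D x fun _ => y - x) ?_ ?_ 1 (right_mem_Icc.2 zero_le_one)
  · simpa [Finset.sum_range_succ, sub_sub] using h
  · intro k hk s hs
    have h1 := hf.differentiableOn_iteratedFDerivWithin (m := k) (by exact_mod_cast hk) hu _
      (hmaps hs)
    refine (hasDerivWithinAt_multilinear_apply_const h1.hasFDerivWithinAt hmaps).congr_deriv ?_
    rw [iteratedFDerivWithin_succ_apply_left]
    rfl
  · intro s hs
    refine ((iteratedFDerivWithin ℝ q f D (x + s • (y - x)) -
      iteratedFDerivWithin ℝ q f D x).le_opNorm (fun _ => y - x)).trans ?_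
    simpa using mul_le_mul_of_nonneg_right (hC _ (hmaps hs)) (by positivity)

/-- The polynomial stops at degree `p - 1`: the `p`-th derivative is only known to be bounded, so it
goes entirely into the remainder. -/
theorem HasBoundedDerivs.norm_sub_taylor_le {X : Type*} [NormedAddCommGroup X] [NormedSpace ℝ X]
    {g : X → X} {V D : Set X} {p : ℕ} {B : ℝ} (hg : HasBoundedDerivs g V p B) (hV : IsOpen V)
    (hD : Convex ℝ D) (hDV : D ⊆ V) {x h : X} (hx : x ∈ D) (hh : x + h ∈ D) :
    ‖g (x + h) - ∑ k ∈ Finset.range p,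
      ((k.factorial : ℝ)⁻¹) • iteratedFDeriv ℝ k g x (fun _ => h)‖ ≤ B * ‖h‖ ^ p := by
  have hmaps : MapsTo (fun s : ℝ => x + s • h) (Icc 0 1) D := fun s hs =>
    by simpa using hD.add_smul_sub_mem hx hh hs
  have h := norm_taylor_remainder_le (n := p) (C := B * ‖h‖ ^ p)
    (φ := fun k s => iteratedFDeriv ℝ k g (x + s • h) fun _ => h)
    (a := 0) ?_ ?_ 1 (right_mem_Icc.2 zero_le_one)
  · simpa using h
  · intro k hk s hs
    have h1 := ((hg.differentiableOn k hk).differentiableAt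
      (hV.mem_nhds (hDV (hmaps hs)))).hasFDerivAt.hasFDerivWithinAt (s := D)
    refine (hasDerivWithinAt_multilinear_apply_const h1 hmaps).congr_deriv ?_
    rw [iteratedFDeriv_succ_apply_left]
    rfl
  · intro s hs
    rw [sub_zero]
    refine ((iteratedFDeriv ℝ p g (x + s • h)).le_opNorm (fun _ => h)).trans ?_
    simpa using mul_le_mul_of_nonneg_right (hg.bound p le_rfl _ (hDV (hmaps hs)))
      (pow_nonneg (norm_nonneg h) p)

theorem HasBoundedDerivs.norm_sub_le {X : Type*} [NormedAddCommGroup X] [NormedSpace ℝ X]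
    {g : X → X} {V D : Set X} {p : ℕ} {B : ℝ} (hg : HasBoundedDerivs g V p B) (hV : IsOpen V)
    (hp : 1 ≤ p) (hD : Convex ℝ D) (hDV : D ⊆ V) {x y : X} (hx : x ∈ D) (hy : y ∈ D) :
    ‖g x - g y‖ ≤ B * ‖x - y‖ := by
  have hg1 : HasBoundedDerivs g V 1 B :=
    ⟨fun k hk => hg.differentiableOn k (by omega), fun k hk => hg.bound k (by omega)⟩
  simpa using hg1.norm_sub_taylor_le hV hD hDV hy (h := x - y) (by simpa using hx)

theorem HasBoundedDerivs.norm_le {X : Type*} [NormedAddCommGroup X] [NormedSpace ℝ X]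
    {g : X → X} {V : Set X} {p : ℕ} {B : ℝ} (hg : HasBoundedDerivs g V p B) {x : X} (hx : x ∈ V) :
    ‖g x‖ ≤ B := by
  simpa using hg.bound 0 (Nat.zero_le _) x hx

/-! ## The domains of the integrands -/

namespace RTree

theorem IsOrdered.mem_Icc {t : RTree} {ζ : ℝ} {σ : t.Nodes → ℝ} (h : t.IsOrdered ζ σ)
    (v : t.Nodes) : σ v ∈ Icc 0 ζ := by
  induction t generalizing ζ with
  | node k child ih =>
    obtain ⟨h1, h2, h3⟩ := h
    match (v : Option (Σ i : Fin k, (child i).Nodes)) with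
    | none => exact ⟨h1, h2⟩
    | some ⟨i, v⟩ => exact Icc_subset_Icc_right h2 (ih i (h3 i) v)

theorem isOrdered_zero (t : RTree) {ζ : ℝ} (hζ : 0 ≤ ζ) : t.IsOrdered ζ 0 := by
  induction t generalizing ζ with
  | node k child ih => exact ⟨le_rfl, hζ, fun i => ih i le_rfl⟩

theorem IsOrdered.combo {t : RTree} {ζ ζ' : ℝ} {σ σ' : t.Nodes → ℝ} (h : t.IsOrdered ζ σ)
    (h' : t.IsOrdered ζ' σ') {a b : ℝ} (ha : 0 ≤ a) (hb : 0 ≤ b) :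
    t.IsOrdered (a * ζ + b * ζ') (a • σ + b • σ') := by
  induction t generalizing ζ ζ' with
  | node k child ih =>
    obtain ⟨h1, h2, h3⟩ := h
    obtain ⟨h1', h2', h3'⟩ := h'
    exact ⟨add_nonneg (mul_nonneg ha h1) (mul_nonneg hb h1'),
      add_le_add (mul_le_mul_of_nonneg_left h2 ha) (mul_le_mul_of_nonneg_left h2' hb),
      fun i => ih i (h3 i) (h3' i)⟩

/-- The variant of `IsOrdered` with strict inequalities. -/
def IsStrictOrdered : (t : RTree) → ℝ → (t.Nodes → ℝ) → Prop
  | node _ child, ζ, σ =>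
    0 < rootVar σ ∧ rootVar σ < ζ ∧ ∀ i, (child i).IsStrictOrdered (rootVar σ) (subVars σ i)

theorem IsStrictOrdered.isOrdered {t : RTree} {ζ : ℝ} {σ : t.Nodes → ℝ}
    (h : t.IsStrictOrdered ζ σ) : t.IsOrdered ζ σ := by
  induction t generalizing ζ with
  | node k child ih => exact ⟨h.1.le, h.2.1.le, fun i => ih i (h.2.2 i)⟩

theorem exists_isStrictOrdered (t : RTree) {ζ : ℝ} (hζ : 0 < ζ) :
    ∃ σ : t.Nodes → ℝ, t.IsStrictOrdered ζ σ := by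
  induction t generalizing ζ with
  | node k child ih =>
    choose σ hσ using fun i => ih i (half_pos hζ)
    exact ⟨(nodesArrowEquiv child ℝ).symm (ζ / 2, σ), half_pos hζ, half_lt_self hζ, hσ⟩

theorem isOpen_setOf_isStrictOrdered (t : RTree) {Y : Type*} [TopologicalSpace Y] {ζ : Y → ℝ}
    {σ : Y → t.Nodes → ℝ} (hζ : Continuous ζ) (hσ : ∀ v, Continuous fun y => σ y v) :
    IsOpen {y | t.IsStrictOrdered (ζ y) (σ y)} := by
  induction t generalizing ζ with
  | node k child ih =>
    have hr : Continuous fun y => rootVar (σ y) := hσ (root _)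
    have h : {y | (node k child).IsStrictOrdered (ζ y) (σ y)} =
        {y | 0 < rootVar (σ y)} ∩ ({y | rootVar (σ y) < ζ y} ∩
          ⋂ i, {y | (child i).IsStrictOrdered (rootVar (σ y)) (subVars (σ y) i)}) := by
      ext y
      simp only [mem_inter_iff, mem_iInter, mem_ofPred_eq]
      rfl
    rw [h]
    exact (isOpen_lt continuous_const hr).inter ((isOpen_lt hr hζ).inter
      (isOpen_iInter_of_finite fun i => ih i hr fun v => hσ (sub i v)))

end RTree

theorem Setting.convex_domain (m : Setting) (t : RTree) : Convex ℝ (m.domain t) := by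
  intro σ hσ σ' hσ' a b ha hb hab
  cases m with
  | group =>
    intro v
    exact convex_Icc (0 : ℝ) 1 (hσ v) (hσ' v) ha hb hab
  | semigroup =>
    have h := IsOrdered.combo (show t.IsOrdered 1 σ from hσ) hσ' ha hb
    rw [mul_one, mul_one, hab] at h
    exact h

theorem Setting.mem_domain_of_isOrdered (m : Setting) {t : RTree} {σ : t.Nodes → ℝ}
    (h : t.IsOrdered 1 σ) : σ ∈ m.domain t := by
  cases m with
  | group => exact h.mem_Icc
  | semigroup => exact h

theorem Setting.mem_Icc_of_mem_domain {m : Setting} {t : RTree} {σ : t.Nodes → ℝ}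
    (h : σ ∈ m.domain t) (v : t.Nodes) : σ v ∈ Icc (0 : ℝ) 1 := by
  cases m with
  | group => exact h v
  | semigroup => exact IsOrdered.mem_Icc (show t.IsOrdered 1 σ from h) v

/-- A convex set with an interior point: strictly ordered points exist, form an open set and lie in
the domain in both settings. This makes derivatives within the domain meaningful at the corner `0`.
-/
theorem Setting.uniqueDiffOn_domain (m : Setting) (t : RTree) : UniqueDiffOn ℝ (m.domain t) := by
  refine uniqueDiffOn_convex (m.convex_domain t) ?_
  obtain ⟨σ, hσ⟩ := exists_isStrictOrdered t one_pos
  exact ⟨σ, mem_interior.2 ⟨{σ | t.IsStrictOrdered 1 σ},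
    fun σ h => m.mem_domain_of_isOrdered h.isOrdered,
    isOpen_setOf_isStrictOrdered t continuous_const (fun v => continuous_apply v), hσ⟩⟩

end Lawson

namespace Lawson
open RTree

variable {s : ℕ}

/-! ## Weights and moments -/

theorem abs_moment_le {L : Fin s → Fin s → ℝ} {c : Fin s → ℝ} {Λ : ℝ}
    (hc : ∀ j, |c j| ≤ 1) (hL : ∀ i, ∑ j, |L i j| ≤ Λ) (t : RTree) (d : t.Nodes → ℕ)
    {r : Fin s → ℝ} (hr : ∑ j, |r j| ≤ Λ) : |moment L c t d r| ≤ Λ ^ t.order := by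
  have hΛ : 0 ≤ Λ := (Finset.sum_nonneg fun j _ => abs_nonneg (r j)).trans hr
  induction t generalizing r with
  | node k child ih =>
    rw [moment, order_node, pow_add, pow_one, ← Finset.prod_pow_eq_pow_sum]
    refine (Finset.abs_sum_le_sum_abs _ _).trans
      (le_trans (Finset.sum_le_sum fun j _ => ?_) (le_trans (Finset.sum_mul _ _ _).ge
        (mul_le_mul_of_nonneg_right hr (Finset.prod_nonneg fun i _ => pow_nonneg hΛ _))))
    rw [abs_mul, abs_mul, abs_pow, Finset.abs_prod]
    refine mul_le_mul_of_nonneg_left ?_ (abs_nonneg _)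
    refine (mul_le_of_le_one_left (Finset.prod_nonneg fun i _ => abs_nonneg _)
      (pow_le_one₀ (abs_nonneg _) (hc j))).trans ?_
    exact Finset.prod_le_prod (fun i _ => abs_nonneg _) fun i _ => ih i _ (hL j)

theorem abs_weight (L : Fin s → Fin s → ℝ) (t : RTree) (r : Fin s → ℝ) (a : t.Nodes → Fin s) :
    |weight L t r a| = weight (fun i j => |L i j|) t (fun j => |r j|) a := by
  induction t generalizing r with
  | node k child ih => simp only [weight, abs_mul, Finset.abs_prod, ih]

open Classical in
theorem sum_abs_weight_le {L : Fin s → Fin s → ℝ} {Λ : ℝ} (hL : ∀ i, ∑ j, |L i j| ≤ Λ)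
    (t : RTree) {r : Fin s → ℝ} (hr : ∑ j, |r j| ≤ Λ) :
    ∑ a, |weight L t r a| ≤ Λ ^ t.order := by
  -- All exponents are zero, so this moment is the plain sum of the weights, and the choice of the
  -- quadrature nodes is immaterial.
  have h := abs_moment_le (L := fun i j => |L i j|) (c := fun _ => 0) (Λ := Λ) (by simp)
    (by simpa using hL) t 0 (r := fun j => |r j|) (by simpa using hr)
  rw [moment_eq_sum] at h
  simpa [abs_weight] using (le_abs_self _).trans h

/-- A nonzero weight forces a nonzero coefficient along every edge. Hence with monotone nodes only
points of the semigroup domain contribute to the formula. -/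
theorem isOrdered_of_weight_ne_zero {L : Fin s → Fin s → ℝ} {c : Fin s → ℝ} (hc : ∀ j, 0 ≤ c j)
    (hL : ∀ i j, L i j ≠ 0 → c j ≤ c i) {t : RTree} {r : Fin s → ℝ} {ζ : ℝ}
    (hr : ∀ j, r j ≠ 0 → c j ≤ ζ) {a : t.Nodes → Fin s} (ha : weight L t r a ≠ 0) :
    t.IsOrdered ζ (fun v => c (a v)) := by
  induction t generalizing r ζ with
  | node k child ih =>
    rw [weight, mul_ne_zero_iff, Finset.prod_ne_zero_iff] at ha
    exact ⟨hc _, hr _ ha.1, fun i => ih i (hL _) (ha.2 i (Finset.mem_univ i))⟩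

/-! ## Quadrature of functions with a Taylor expansion -/

open Classical in
/-- The exponents of the monomial `∏ i, σ (f i)`. -/
def exponents {N : Type*} {k : ℕ} (f : Fin k → N) (v : N) : ℕ :=
  Finset.card {i | f i = v}

theorem sum_exponents {N : Type*} [Fintype N] {k : ℕ} (f : Fin k → N) :
    ∑ v, exponents f v = k := by
  classical
  simpa [exponents] using
    (Finset.card_eq_sum_card_fiberwise (s := Finset.univ) (t := Finset.univ) (f := f)
      (by simp)).symm

theorem prod_pow_exponents {N : Type*} [Fintype N] {k : ℕ} (f : Fin k → N) (σ : N → ℝ) :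
    ∏ v, σ v ^ exponents f v = ∏ i, σ (f i) := by
  classical
  rw [← Finset.prod_fiberwise' Finset.univ f σ]
  simp [exponents]

variable {X : Type*} [NormedAddCommGroup X] [NormedSpace ℝ X]

open Classical in
/-- The linear functional with moments `μ`, applied to the polynomial with homogeneous parts
`σ ↦ A k (σ, …, σ)`. -/
def applyMoments {N : Type*} [Fintype N] (q : ℕ) (A : (k : ℕ) → (N → ℝ) [×k]→L[ℝ] X)
    (μ : (N → ℕ) → ℝ) : X :=
  ∑ k ∈ Finset.range (q + 1), ((k.factorial : ℝ)⁻¹) •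
    ∑ f : Fin k → N, μ (exponents f) • A k (fun i => Pi.single (f i) 1)

theorem map_const_eq_sum {N : Type*} [Fintype N] [DecidableEq N] {k : ℕ}
    (A : (N → ℝ) [×k]→L[ℝ] X) (σ : N → ℝ) :
    A (fun _ => σ) =
      ∑ f : Fin k → N, (∏ v, σ v ^ exponents f v) • A (fun i => Pi.single (f i) 1) := by
  have h : σ = ∑ v, σ v • (Pi.single v 1 : N → ℝ) := by
    simpa [← Pi.single_smul] using (Finset.univ_sum_single σ).symm
  calc A (fun _ => σ) = A (fun _ => ∑ v, σ v • (Pi.single v 1 : N → ℝ)) := by rw [← h]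
    _ = _ := by
      rw [A.map_sum]
      refine Finset.sum_congr rfl fun f _ => ?_
      rw [A.map_smul_univ, prod_pow_exponents]

-- The Taylor polynomial at `0` is a combination of monomials, on which the formula takes the values
-- `moment`. The remainder is at most `C` at each contributing point, as these have supremum norm at
-- most one.
open Classical in
theorem norm_sum_weight_sub_le (m : Setting) {L : Fin s → Fin s → ℝ} {c : Fin s → ℝ} {Λ C : ℝ}
    (hL : ∀ i, ∑ j, |L i j| ≤ Λ) (t : RTree) {r : Fin s → ℝ} (hr : ∑ j, |r j| ≤ Λ)
    (hdom : ∀ a, weight L t r a ≠ 0 → (fun v => c (a v)) ∈ m.domain t)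
    {F : (t.Nodes → ℝ) → X} {q : ℕ} (hF : ContDiffOn ℝ q F (m.domain t))
    (hC : ∀ z ∈ m.domain t, ‖iteratedFDerivWithin ℝ q F (m.domain t) z -
      iteratedFDerivWithin ℝ q F (m.domain t) 0‖ ≤ C) :
    ‖∑ a, weight L t r a • F (fun v => c (a v)) -
      applyMoments q (fun k => iteratedFDerivWithin ℝ k F (m.domain t) 0)
        (fun d => moment L c t d r)‖ ≤ Λ ^ t.order * C := by
  have h0 : (0 : t.Nodes → ℝ) ∈ m.domain t :=
    m.mem_domain_of_isOrdered (t.isOrdered_zero zero_le_one)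
  have hC0 : 0 ≤ C := (norm_nonneg _).trans (hC 0 h0)
  have hrw : applyMoments q (fun k => iteratedFDerivWithin ℝ k F (m.domain t) 0)
        (fun d => moment L c t d r) = ∑ a, weight L t r a •
      ∑ k ∈ Finset.range (q + 1), ((k.factorial : ℝ)⁻¹) •
        iteratedFDerivWithin ℝ k F (m.domain t) 0 (fun _ v => c (a v)) := by
    simp only [applyMoments, Finset.smul_sum]
    rw [Finset.sum_comm]
    refine Finset.sum_congr rfl fun k _ => ?_
    simp only [map_const_eq_sum, moment_eq_sum, Finset.sum_smul, Finset.smul_sum]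
    rw [Finset.sum_comm]
    refine Finset.sum_congr rfl fun a _ => Finset.sum_congr rfl fun f _ => ?_
    simp only [smul_smul]
    congr 1
    ring
  rw [hrw, ← Finset.sum_sub_distrib]
  refine (norm_sum_le _ _).trans (le_trans (Finset.sum_le_sum fun a _ => ?_)
    (le_trans (Finset.sum_mul _ _ _).ge
      (mul_le_mul_of_nonneg_right (sum_abs_weight_le hL t hr) hC0)))
  rw [← smul_sub, norm_smul, Real.norm_eq_abs]
  by_cases ha : weight L t r a = 0
  · simp [ha]
  refine mul_le_mul_of_nonneg_left ?_ (abs_nonneg _)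
  have h := norm_sub_taylor_within_le (m.convex_domain t) (m.uniqueDiffOn_domain t) hF h0
    (hdom a ha) hC
  simp only [sub_zero] at h
  refine h.trans (mul_le_of_le_one_right hC0 (pow_le_one₀ (norm_nonneg _) ?_))
  refine (pi_norm_le_iff_of_nonneg zero_le_one).2 fun v => ?_
  have hv := Setting.mem_Icc_of_mem_domain (hdom a ha) v
  rw [Real.norm_eq_abs, abs_of_nonneg hv.1]
  exact hv.2

/-! ## The explicit Euler method with small steps -/

/-- `N` steps of the explicit Euler method, each of length `1 / N`. -/
def euler (N : ℕ) : ExplicitRK N where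
  a _ _ := 1 / N
  b _ := 1 / N
  c i := i / N
  row_sum i := by
    have h : Fintype.card {j : Fin N // j < i} = i := by
      rw [← Fin.card_Iio i, Fintype.card_subtype]
      congr 1
      ext j
      simp
    simp [h, div_eq_mul_inv]

/-- The weights of the left Riemann sum on `[0, i / N]`. -/
def eulerRow (N i : ℕ) (j : Fin N) : ℝ := if (j : ℕ) < i then 1 / N else 0

theorem euler_lower (N : ℕ) (i : Fin N) : (euler N).lower i = eulerRow N i := by
  funext j
  simp only [ExplicitRK.lower, eulerRow, euler, Fin.lt_def]

theorem euler_b (N : ℕ) : (euler N).b = eulerRow N N := by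
  funext j
  simp [eulerRow, euler]

theorem sum_eulerRow_mul {N i : ℕ} (hi : i ≤ N) {E : Type*} [AddCommGroup E] [Module ℝ E]
    (f : ℕ → E) :
    ∑ j, eulerRow N i j • f j = (1 / N : ℝ) • ∑ j ∈ Finset.range i, f j := by
  have h : ∀ j : Fin N, eulerRow N i j • f j =
      (fun j : ℕ => if j < i then (1 / N : ℝ) • f j else 0) j := by
    intro j; simp only [eulerRow]; split_ifs <;> simp
  simp only [h]
  rw [Fin.sum_univ_eq_sum_range (fun j : ℕ => if j < i then (1 / N : ℝ) • f j else 0) N,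
    ← Finset.sum_filter, Finset.smul_sum]
  refine Finset.sum_congr ?_ fun _ _ => rfl
  ext j
  simp
  omega

theorem sum_abs_eulerRow_le {N i : ℕ} (hi : i ≤ N) : ∑ j, |eulerRow N i j| ≤ 1 := by
  have h0 : ∀ j, |eulerRow N i j| = eulerRow N i j • (1 : ℝ) := by
    intro j
    have : 0 ≤ eulerRow N i j := by unfold eulerRow; split_ifs <;> positivity
    simp [abs_of_nonneg this]
  simp only [h0]
  rw [sum_eulerRow_mul hi (fun _ => (1 : ℝ))]
  simp only [Finset.sum_const, Finset.card_range, nsmul_eq_mul, mul_one, smul_eq_mul, one_div]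
  rw [inv_mul_eq_div]
  exact div_le_one_of_le₀ (by exact_mod_cast hi) (Nat.cast_nonneg N)

/-- The integral of `(n + 1) t ^ n` over `[x, y]` lies between its left and right rectangles. -/
theorem pow_succ_sub_pow_succ_mem {x y : ℝ} (hx : 0 ≤ x) (hxy : x ≤ y) (n : ℕ) :
    (n + 1) * ((y - x) * x ^ n) ≤ y ^ (n + 1) - x ^ (n + 1) ∧
      y ^ (n + 1) - x ^ (n + 1) ≤ (n + 1) * ((y - x) * y ^ n) := by
  have hy : 0 ≤ y := hx.trans hxy
  induction n with
  | zero => simp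
  | succ n ih =>
    have h1 : y ^ (n + 2) - x ^ (n + 2) = y * (y ^ (n + 1) - x ^ (n + 1)) +
      (y - x) * x ^ (n + 1) := by ring
    have hp : x ^ (n + 1) ≤ y ^ (n + 1) := by gcongr
    have hxy0 : 0 ≤ y - x := sub_nonneg.2 hxy
    push_cast
    constructor
    · have h2 := mul_le_mul_of_nonneg_left ih.1 hy
      have h3 : (n + 1) * ((y - x) * x ^ (n + 1)) ≤ y * ((n + 1) * ((y - x) * x ^ n)) := by
        have : x ^ (n + 1) ≤ y * x ^ n := by rw [pow_succ']; gcongr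
        calc (n + 1) * ((y - x) * x ^ (n + 1)) ≤ (n + 1) * ((y - x) * (y * x ^ n)) := by gcongr
          _ = _ := by ring
      rw [h1]
      linarith
    · have h2 := mul_le_mul_of_nonneg_left ih.2 hy
      have h3 := mul_le_mul_of_nonneg_left hp hxy0
      have h4 : y * ((n + 1) * ((y - x) * y ^ n)) = (n + 1) * ((y - x) * y ^ (n + 1)) := by ring
      rw [h1]
      linarith

theorem abs_riemannSum_pow_sub_le {N i : ℕ} (hN : 0 < N) (hi : i ≤ N) (n : ℕ) :
    |∑ j, eulerRow N i j * ((j : ℕ) / N : ℝ) ^ n - (i / N : ℝ) ^ (n + 1) / (n + 1)| ≤ 1 / N := by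
  have hs := sum_eulerRow_mul hi (fun j => ((j : ℕ) / N : ℝ) ^ n)
  simp only [smul_eq_mul] at hs
  rw [hs]
  have hN' : (0 : ℝ) < N := by exact_mod_cast hN
  -- The factor `(i / N) ^ n` makes the upper bound telescope: a cell adds at most `1 / N` times the
  -- increment of the power.
  have key : ∀ i : ℕ, 0 ≤ (i / N : ℝ) ^ (n + 1) / (n + 1) -
        1 / N * ∑ j ∈ Finset.range i, ((j : ℕ) / N : ℝ) ^ n ∧
      (i / N : ℝ) ^ (n + 1) / (n + 1) - 1 / N * ∑ j ∈ Finset.range i, ((j : ℕ) / N : ℝ) ^ n ≤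
        1 / N * (i / N : ℝ) ^ n := by
    intro i
    induction i with
    | zero => simp; positivity
    | succ i ih =>
      have h := pow_succ_sub_pow_succ_mem (x := (i / N : ℝ)) (y := ((i + 1 : ℕ) / N : ℝ))
        (by positivity) (by gcongr; omega) n
      have h1 : ((i + 1 : ℕ) / N : ℝ) - i / N = 1 / N := by push_cast; ring
      rw [h1, ← le_div_iff₀' (by positivity), ← div_le_iff₀' (by positivity), sub_div] at h
      rw [Finset.sum_range_succ, mul_add]
      constructor <;> linarith [ih.1, ih.2, h.1, h.2]
  rw [abs_sub_comm, abs_of_nonneg (key i).1]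
  refine (key i).2.trans (mul_le_of_le_one_right (by positivity) (pow_le_one₀ (by positivity) ?_))
  exact div_le_one_of_le₀ (by exact_mod_cast hi) hN'.le

theorem abs_prod_sub_prod_le {ι : Type*} (S : Finset ι) {a b : ι → ℝ} (ha : ∀ i, |a i| ≤ 1)
    (hb : ∀ i, |b i| ≤ 1) : |∏ i ∈ S, a i - ∏ i ∈ S, b i| ≤ ∑ i ∈ S, |a i - b i| := by
  classical
  induction S using Finset.induction_on with
  | empty => simp
  | insert x S hx ih =>
    rw [Finset.prod_insert hx, Finset.prod_insert hx, Finset.sum_insert hx]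
    have h1 : |∏ i ∈ S, a i| ≤ 1 := by
      rw [Finset.abs_prod]; exact Finset.prod_le_one (fun i _ => abs_nonneg _) fun i _ => ha i
    calc |a x * ∏ i ∈ S, a i - b x * ∏ i ∈ S, b i|
        = |(a x - b x) * ∏ i ∈ S, a i + b x * (∏ i ∈ S, a i - ∏ i ∈ S, b i)| := by ring_nf
      _ ≤ |a x - b x| * |∏ i ∈ S, a i| + |b x| * |∏ i ∈ S, a i - ∏ i ∈ S, b i| := by
        rw [← abs_mul, ← abs_mul]; exact abs_add_le _ _
      _ ≤ |a x - b x| * 1 + 1 * ∑ i ∈ S, |a i - b i| := by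
        gcongr
        exact hb x
      _ = _ := by ring

theorem exactMoment_mem_Icc (t : RTree) (d : t.Nodes → ℕ) : exactMoment t d ∈ Icc (0 : ℝ) 1 := by
  induction t with
  | node k child ih =>
    rw [exactMoment]
    refine ⟨div_nonneg (Finset.prod_nonneg fun i _ => (ih i _).1) (Nat.cast_nonneg _), ?_⟩
    refine div_le_one_of_le₀ ((Finset.prod_le_one (fun i _ => (ih i _).1)
      fun i _ => (ih i _).2).trans ?_) (Nat.cast_nonneg _)
    rw [degree_node]
    exact_mod_cast Nat.le_add_left 1 _

theorem euler_c_mem_Icc {N : ℕ} (j : Fin N) : (euler N).c j ∈ Icc (0 : ℝ) 1 :=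
  ⟨div_nonneg (Nat.cast_nonneg _) (Nat.cast_nonneg _),
    div_le_one_of_le₀ (by exact_mod_cast j.2.le) (Nat.cast_nonneg N)⟩

/-- All upper limits `i / N` are treated, because the subtrees of a node at `j / N` are integrated
up to `j / N` only. By homogeneity the exact value is then scaled by a power of `i / N`. -/
theorem exists_abs_euler_moment_sub_le (t : RTree) (d : t.Nodes → ℕ) :
    ∃ κ : ℝ, ∀ N i : ℕ, 0 < N → i ≤ N →
      |moment (euler N).lower (euler N).c t d (eulerRow N i) -
        exactMoment t d * (i / N : ℝ) ^ (t.order + ∑ v, d v)| ≤ κ / N := by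
  induction t with
  | node k child ih =>
    choose κ hκ using fun i => ih i (fun v => d (sub i v))
    -- The errors of the subtrees add up; the summand one is the error of the Riemann sum for the
    -- root.
    refine ⟨∑ l, κ l + 1, fun N i hN hi => ?_⟩
    have hN' : (0 : ℝ) < N := by exact_mod_cast hN
    set n : ℕ := d (root (node k child)) + ∑ i, ((child i).order + ∑ v, d (sub i v)) with hn
    set P : ℝ := ∏ l, exactMoment (child l) (fun v => d (sub l v)) with hP
    have hP1 : |P| ≤ 1 := by
      rw [hP, Finset.abs_prod]
      exact Finset.prod_le_one (fun i _ => abs_nonneg _) fun i _ => by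
        rw [abs_of_nonneg (exactMoment_mem_Icc _ _).1]
        exact (exactMoment_mem_Icc _ _).2
    have hc1 : ∀ j : Fin N, |(euler N).c j| ≤ 1 := fun j => by
      rw [abs_of_nonneg (euler_c_mem_Icc j).1]; exact (euler_c_mem_Icc j).2
    have hexact : exactMoment (.node k child) d = P / (n + 1) := by
      rw [exactMoment, degree_node, ← hn, Nat.cast_add_one]
    have hprod : ∀ j : Fin N, |(euler N).c j ^ d (root (.node k child)) *
        ∏ l, moment (euler N).lower (euler N).c (child l) (fun v => d (sub l v))
          ((euler N).lower j) - P * (j / N : ℝ) ^ n| ≤ (∑ l, κ l) / N := by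
      intro j
      have h1 : P * (j / N : ℝ) ^ n = (euler N).c j ^ d (root (.node k child)) *
          ∏ l, exactMoment (child l) (fun v => d (sub l v)) *
            (j / N : ℝ) ^ ((child l).order + ∑ v, d (sub l v)) := by
        rw [Finset.prod_mul_distrib, Finset.prod_pow_eq_pow_sum, hn, pow_add]
        simp only [euler]
        ring
      rw [h1, ← mul_sub, abs_mul, abs_pow]
      refine (mul_le_of_le_one_left (abs_nonneg _) (pow_le_one₀ (abs_nonneg _) (hc1 j))).trans ?_
      rw [euler_lower]
      refine (abs_prod_sub_prod_le _ (fun l => ?_) (fun l => ?_)).trans ?_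
      · refine (abs_moment_le (Λ := 1) hc1 (fun i => ?_) (child l) _
          (sum_abs_eulerRow_le j.2.le)).trans (by simp)
        rw [euler_lower]
        exact sum_abs_eulerRow_le i.2.le
      · have h2 := exactMoment_mem_Icc (child l) (fun v => d (sub l v))
        have h3 := euler_c_mem_Icc j
        rw [abs_mul, abs_of_nonneg h2.1, abs_pow]
        exact mul_le_one₀ h2.2 (by positivity) (pow_le_one₀ (abs_nonneg _) (hc1 j))
      · rw [Finset.sum_div]
        exact Finset.sum_le_sum fun l _ => hκ l N j hN j.2.le
    have hr := abs_riemannSum_pow_sub_le hN hi n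
    rw [degree_node, ← hn, hexact, moment]
    calc |∑ j, eulerRow N i j * ((euler N).c j ^ d (root (.node k child)) *
          ∏ l, moment (euler N).lower (euler N).c (child l) (fun v => d (sub l v))
            ((euler N).lower j)) - P / (n + 1) * (i / N : ℝ) ^ (n + 1)|
        = |∑ j, eulerRow N i j * ((euler N).c j ^ d (root (.node k child)) *
            ∏ l, moment (euler N).lower (euler N).c (child l) (fun v => d (sub l v))
              ((euler N).lower j) - P * (j / N : ℝ) ^ n) +
            P * (∑ j, eulerRow N i j * ((j : ℕ) / N : ℝ) ^ n -
              (i / N : ℝ) ^ (n + 1) / (n + 1))| := by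
          congr 1
          simp only [mul_sub, Finset.sum_sub_distrib, Finset.mul_sum]
          simp only [mul_left_comm P]
          ring
      _ ≤ ∑ j, |eulerRow N i j| * ((∑ l, κ l) / N) + 1 * (1 / N) := by
          refine (abs_add_le _ _).trans (add_le_add ?_ ?_)
          · refine (Finset.abs_sum_le_sum_abs _ _).trans (Finset.sum_le_sum fun j _ => ?_)
            rw [abs_mul]
            exact mul_le_mul_of_nonneg_left (hprod j) (abs_nonneg _)
          · rw [abs_mul]
            exact mul_le_mul hP1 hr (abs_nonneg _) zero_le_one
      _ ≤ _ := by
          have h0 : 0 ≤ (∑ l, κ l) / N := (abs_nonneg _).trans (hprod ⟨0, hN⟩)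
          rw [← Finset.sum_mul, add_div, one_mul]
          exact add_le_add_left (mul_le_of_le_one_left h0 (sum_abs_eulerRow_le hi)) _

theorem tendsto_euler_moment (t : RTree) (d : t.Nodes → ℕ) :
    Tendsto (fun N => moment (euler N).lower (euler N).c t d (euler N).b) atTop
      (𝓝 (exactMoment t d)) := by
  obtain ⟨κ, hκ⟩ := exists_abs_euler_moment_sub_le t d
  refine tendsto_iff_norm_sub_tendsto_zero.2 (squeeze_zero' (Eventually.of_forall fun N =>
    norm_nonneg _) ?_ (tendsto_const_div_atTop_nhds_zero_nat κ))
  filter_upwards [eventually_gt_atTop 0] with N hN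
  have h := hκ N N hN le_rfl
  have hN' : (N : ℝ) ≠ 0 := by exact_mod_cast hN.ne'
  rw [div_self hN', one_pow, mul_one, ← euler_b] at h
  exact h

end Lawson

namespace Lawson
open RTree

variable {s : ℕ} {X : Type*} [NormedAddCommGroup X] [NormedSpace ℝ X]

/-! ## Exponential quadrature -/

/-- The quadrature formula with nodes `c` and weights `r` for
`∫ e^{-(ζ-σ)τA} f(σ) dσ`, where `f` is given by its values at the nodes. -/
def quad (S : ℝ → X →L[ℝ] X) (τ : ℝ) (c r : Fin s → ℝ) (ζ : ℝ) (f : Fin s → X) : X :=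
  ∑ j, r j • S ((ζ - c j) * τ) (f j)

/-- The operators that occur in a quadrature formula are bounded by `CE`, and the sum of the
absolute values of the weights is at most `Λ`. -/
structure RowBound (S : ℝ → X →L[ℝ] X) (τ CE Λ : ℝ) (c r : Fin s → ℝ) (ζ : ℝ) : Prop where
  flow : ∀ j, r j ≠ 0 → ‖S ((ζ - c j) * τ)‖ ≤ CE
  weights : ∑ j, |r j| ≤ Λ

theorem quad_sub (S : ℝ → X →L[ℝ] X) (τ : ℝ) (c r : Fin s → ℝ) (ζ : ℝ) (f f' : Fin s → X) :
    quad S τ c r ζ f - quad S τ c r ζ f' = quad S τ c r ζ (fun j => f j - f' j) := by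
  simp only [quad, map_sub, smul_sub, Finset.sum_sub_distrib]

theorem RowBound.norm_quad_le {S : ℝ → X →L[ℝ] X} {τ CE Λ : ℝ} {c r : Fin s → ℝ} {ζ : ℝ}
    (h : RowBound S τ CE Λ c r ζ) (hCE : 0 ≤ CE) {f : Fin s → X} {b : ℝ} (hb : 0 ≤ b)
    (hf : ∀ j, r j ≠ 0 → ‖f j‖ ≤ b) : ‖quad S τ c r ζ f‖ ≤ Λ * CE * b := by
  refine (norm_sum_le _ _).trans (le_trans (Finset.sum_le_sum fun j _ => ?_)
    (le_trans (Finset.sum_mul _ _ _).ge ((mul_le_mul_of_nonneg_right h.weights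
      (mul_nonneg hCE hb)).trans (mul_assoc _ _ _).ge)))
  rw [norm_smul, Real.norm_eq_abs]
  by_cases hj : r j = 0
  · simp [hj]
  refine mul_le_mul_of_nonneg_left ?_ (abs_nonneg _)
  exact ((S _).le_opNorm _).trans (mul_le_mul (h.flow j hj) (hf j hj) (norm_nonneg _) hCE)

theorem stage_eq (M : ExplicitRK s) (S : ℝ → X →L[ℝ] X) (g : X → X) (τ : ℝ) (x : X) (i : Fin s) :
    stage M S g τ x i = S (M.c i * τ) x +
      τ • quad S τ M.c (M.lower i) (M.c i) (fun j => g (stage M S g τ x j)) := by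
  rw [stage, M.sum_lower i fun j => S ((M.c i - M.c j) * τ) (g (stage M S g τ x j))]
  rfl

theorem step_eq (M : ExplicitRK s) (S : ℝ → X →L[ℝ] X) (g : X → X) (τ : ℝ) (x : X) :
    step M S g τ x = S τ x + τ • quad S τ M.c M.b 1 (fun j => g (stage M S g τ x j)) := rfl

theorem ExplicitRK.lt_of_lower_ne_zero {M : ExplicitRK s} {i j : Fin s} (h : M.lower i j ≠ 0) :
    j < i := by
  by_contra hji
  exact h (if_neg hji)

/-! ## Trees and the expansion of the internal stages -/

/-- The nested quadrature formula of a tree, applied to its integrand. -/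
def treeQuad (M : ExplicitRK s) (S : ℝ → X →L[ℝ] X) (g : X → X) (τ : ℝ) (w : X) (t : RTree)
    (r : Fin s → ℝ) (ζ : ℝ) : X :=
  open Classical in
  ∑ a : t.Nodes → Fin s, weight M.lower t r a • integrand S g τ w t ζ (fun v => M.c (a v))

/-- Multilinearity of the derivative pulls the sums over the subtrees into its arguments. -/
theorem treeQuad_node (M : ExplicitRK s) (S : ℝ → X →L[ℝ] X) (g : X → X) (τ : ℝ) (w : X) {k : ℕ}
    (child : Fin k → RTree) (r : Fin s → ℝ) (ζ : ℝ) :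
    treeQuad M S g τ w (.node k child) r ζ = quad S τ M.c r ζ (fun j =>
      iteratedFDeriv ℝ k g (S (M.c j * τ) w)
        (fun l => treeQuad M S g τ w (child l) (M.lower j) (M.c j))) := by
  classical
  unfold treeQuad
  have h := sum_nodesArrow (child := child) (fun (j : Fin s) b =>
    (r j * ∏ i, weight M.lower (child i) (M.lower j) (b i)) •
      S ((ζ - M.c j) * τ) (iteratedFDeriv ℝ k g (S (M.c j * τ) w)
        (fun i => integrand S g τ w (child i) (M.c j) (fun v => M.c (b i v)))))
  refine Eq.trans ?_ (h.trans ?_)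
  · exact Finset.sum_congr (by congr 1) fun a _ => rfl
  · refine Finset.sum_congr rfl fun j _ => ?_
    beta_reduce
    rw [ContinuousMultilinearMap.map_sum, map_sum, Finset.smul_sum]
    refine Finset.sum_congr rfl fun b _ => ?_
    rw [ContinuousMultilinearMap.map_smul_univ, map_smul, mul_smul]

/-- The approximations of `U_i - e^{-c_iτA} w` which arise from `m` Picard iterations, starting
with zero, if `g` is replaced by its Taylor polynomial of degree `p - 1` at `e^{-c_jτA} w`. -/
def expand (p : ℕ) (M : ExplicitRK s) (S : ℝ → X →L[ℝ] X) (g : X → X) (τ : ℝ) (w : X) :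
    ℕ → (Fin s → ℝ) → ℝ → X
  | 0, _, _ => 0
  | m + 1, r, ζ => τ • quad S τ M.c r ζ (fun j => ∑ k ∈ Finset.range p, ((k.factorial : ℝ)⁻¹) •
      iteratedFDeriv ℝ k g (S (M.c j * τ) w)
        (fun _ => expand p M S g τ w m (M.lower j) (M.c j)))

/-- Every node has fewer than `p` children. -/
def RTree.BranchingLT (p : ℕ) : RTree → Prop
  | .node k child => k < p ∧ ∀ i, (child i).BranchingLT p

universe u

/-- Trees and coefficients are chosen before the method, the space and the equation, so different
methods share them. Repetitions among the trees are harmless. -/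
theorem exists_expand_eq_sum_treeQuad (p m : ℕ) :
    ∃ (ι : Type) (_ : Fintype ι) (T : ι → RTree) (α : ι → ℝ), (∀ i, (T i).BranchingLT p) ∧
      ∀ {s : ℕ} (M : ExplicitRK s) {X : Type u} [NormedAddCommGroup X] [NormedSpace ℝ X]
        (S : ℝ → X →L[ℝ] X) (g : X → X) (τ : ℝ) (w : X) (r : Fin s → ℝ) (ζ : ℝ),
        expand p M S g τ w m r ζ =
          ∑ i, (α i * τ ^ (T i).order) • treeQuad M S g τ w (T i) r ζ := by
  classical
  induction m with
  | zero => exact ⟨Empty, inferInstance, Empty.elim, Empty.elim, fun i => i.elim, by simp [expand]⟩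
  | succ m ih =>
    obtain ⟨ι, _, T, α, hT, h⟩ := ih
    -- Inserting the previous sum into the `k`-linear Taylor term gives one new tree for each choice
    -- of `k` old ones.
    refine ⟨Σ k : Fin p, (Fin k → ι), inferInstance, fun q => .node q.1 fun l => T (q.2 l),
      fun q => ((q.1 : ℕ).factorial : ℝ)⁻¹ * ∏ l, α (q.2 l),
      fun q => ⟨q.1.2, fun l => hT _⟩, ?_⟩
    intro s M X _ _ S g τ w r ζ
    rw [Fintype.sum_sigma]
    simp only [treeQuad_node, expand, quad, h]
    simp only [Finset.smul_sum, map_sum]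
    conv_lhs => rw [Finset.sum_comm]
    rw [← Fin.sum_univ_eq_sum_range (fun k => ∑ j, τ • r j • S ((ζ - M.c j) * τ)
      (((k.factorial : ℝ)⁻¹) • iteratedFDeriv ℝ k g (S (M.c j * τ) w)
        (fun _ => ∑ i, (α i * τ ^ (T i).order) •
          treeQuad M S g τ w (T i) (M.lower j) (M.c j)))) p]
    refine Finset.sum_congr rfl fun k _ => ?_
    rw [Finset.sum_comm]
    refine Finset.sum_congr rfl fun j _ => ?_
    rw [ContinuousMultilinearMap.map_sum, Finset.smul_sum, map_sum, Finset.smul_sum,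
      Finset.smul_sum]
    refine Finset.sum_congr rfl fun f _ => ?_
    rw [ContinuousMultilinearMap.map_smul_univ, map_smul, map_smul, order_node,
      Finset.prod_mul_distrib, Finset.prod_pow_eq_pow_sum, pow_add]
    simp only [smul_smul]
    congr 1
    ring

/-! ## Stages near the exact solution -/

/-- A Lawson method near the values `y i` (of the exact solution at the nodes), with
`e^{-c_iτA}w` close to `y i`. -/
structure IsLocal (M : ExplicitRK s) (S : ℝ → X →L[ℝ] X) (g : X → X) (V : Set X) (p : ℕ)
    (B CE Λ r τ : ℝ) (y : Fin s → X) (w : X) : Prop where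
  rows : ∀ i, RowBound S τ CE Λ M.c (M.lower i) (M.c i)
  final : RowBound S τ CE Λ M.c M.b 1
  flow : ∀ i, ‖S (M.c i * τ)‖ ≤ CE
  isOpen : IsOpen V
  deriv : HasBoundedDerivs g V p B
  ball : ∀ i, Metric.ball (y i) r ⊆ V
  near : ∀ i, ‖S (M.c i * τ) w - y i‖ ≤ τ * (CE * B)
  one_le_p : 1 ≤ p
  B_nonneg : 0 ≤ B
  CE_nonneg : 0 ≤ CE
  Λ_nonneg : 0 ≤ Λ
  τ_nonneg : 0 ≤ τ

namespace IsLocal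

variable {M : ExplicitRK s} {S : ℝ → X →L[ℝ] X} {g : X → X} {V : Set X} {p : ℕ}
    {B CE Λ r τ : ℝ} {y : Fin s → X} {w : X}

theorem stage_mem_ball (h : IsLocal M S g V p B CE Λ r τ y w) {x : X}
    (hx : CE * ‖x - w‖ + τ * (CE * B + Λ * CE * B) < r) (i : Fin s) :
    stage M S g τ x i ∈ Metric.ball (y i) r := by
  induction i using WellFoundedLT.induction with
  | _ i ih =>
    have h1 := (h.rows i).norm_quad_le h.CE_nonneg h.B_nonneg
      (f := fun j => g (stage M S g τ x j)) fun j hj =>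
        h.deriv.norm_le (h.ball j (ih j (ExplicitRK.lt_of_lower_ne_zero hj)))
    have h2 : ‖S (M.c i * τ) (x - w)‖ ≤ CE * ‖x - w‖ :=
      ((S _).le_opNorm _).trans (mul_le_mul_of_nonneg_right (h.flow i) (norm_nonneg _))
    rw [mem_ball_iff_norm, stage_eq]
    have h3 : S (M.c i * τ) x + τ • quad S τ M.c (M.lower i) (M.c i)
        (fun j => g (stage M S g τ x j)) - y i = S (M.c i * τ) (x - w) +
        (S (M.c i * τ) w - y i) + τ • quad S τ M.c (M.lower i) (M.c i)
        (fun j => g (stage M S g τ x j)) := by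
      rw [map_sub]; abel
    rw [h3]
    refine (norm_add₃_le).trans_lt (lt_of_le_of_lt ?_ hx)
    rw [norm_smul, Real.norm_eq_abs, abs_of_nonneg h.τ_nonneg]
    have h4 := mul_le_mul_of_nonneg_left h1 h.τ_nonneg
    have h5 := h.near i
    linarith

/-- Stability of the stage equations: as the method is explicit, induction over the stages applies,
and the smallness of `τ` keeps the nonlinear part below `δ`. It serves both for perturbed initial
values and for the exact solution inserted into the Euler method. -/
theorem norm_sub_le_of_defect (h : IsLocal M S g V p B CE Λ r τ y w)
    (hτ : τ * (Λ * CE * B) ≤ 1 / 2) {z U : Fin s → X} {δ : ℝ} (hδ : 0 ≤ δ)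
    (hz : ∀ i, z i ∈ Metric.ball (y i) r) (hU : ∀ i, U i ∈ Metric.ball (y i) r)
    (hd : ∀ i, ‖(z i - τ • quad S τ M.c (M.lower i) (M.c i) (fun j => g (z j))) -
      (U i - τ • quad S τ M.c (M.lower i) (M.c i) (fun j => g (U j)))‖ ≤ δ) (i : Fin s) :
    ‖z i - U i‖ ≤ 2 * δ := by
  induction i using WellFoundedLT.induction with
  | _ i ih =>
    have h1 := (h.rows i).norm_quad_le h.CE_nonneg (b := B * (2 * δ))
      (mul_nonneg h.B_nonneg (by positivity)) (f := fun j => g (z j) - g (U j)) fun j hj =>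
        (h.deriv.norm_sub_le h.isOpen h.one_le_p (convex_ball _ _) (h.ball j) (hz j) (hU j)).trans
          (mul_le_mul_of_nonneg_left (ih j (ExplicitRK.lt_of_lower_ne_zero hj)) h.B_nonneg)
    have h2 : z i - U i = ((z i - τ • quad S τ M.c (M.lower i) (M.c i) (fun j => g (z j))) -
      (U i - τ • quad S τ M.c (M.lower i) (M.c i) (fun j => g (U j)))) +
      τ • quad S τ M.c (M.lower i) (M.c i) (fun j => g (z j) - g (U j)) := by
      rw [← quad_sub, smul_sub]; abel
    rw [h2]
    refine (norm_add_le _ _).trans ((add_le_add (hd i) ?_).trans (two_mul δ).ge)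
    rw [norm_smul, Real.norm_eq_abs, abs_of_nonneg h.τ_nonneg]
    calc τ * ‖quad S τ M.c (M.lower i) (M.c i) (fun j => g (z j) - g (U j))‖
        ≤ τ * (Λ * CE * (B * (2 * δ))) := mul_le_mul_of_nonneg_left h1 h.τ_nonneg
      _ = (τ * (Λ * CE * B)) * (2 * δ) := by ring
      _ ≤ 1 / 2 * (2 * δ) := mul_le_mul_of_nonneg_right hτ (by positivity)
      _ = δ := by ring

theorem norm_quad_final_sub_le (h : IsLocal M S g V p B CE Λ r τ y w) {z U : Fin s → X} {δ : ℝ}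
    (hδ : 0 ≤ δ) (hz : ∀ i, z i ∈ Metric.ball (y i) r) (hU : ∀ i, U i ∈ Metric.ball (y i) r)
    (hzU : ∀ i, ‖z i - U i‖ ≤ δ) :
    ‖quad S τ M.c M.b 1 (fun j => g (z j)) - quad S τ M.c M.b 1 (fun j => g (U j))‖
      ≤ Λ * CE * (B * δ) := by
  rw [quad_sub]
  exact h.final.norm_quad_le h.CE_nonneg (mul_nonneg h.B_nonneg hδ) fun j _ =>
    (h.deriv.norm_sub_le h.isOpen h.one_le_p (convex_ball _ _) (h.ball j) (hz j) (hU j)).trans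
      (mul_le_mul_of_nonneg_left (hzU j) h.B_nonneg)

/-- The linear part `S τ (x - w)` is left out on purpose: the global estimate propagates it without
paying a factor `CE` in each step. -/
theorem norm_quad_stage_sub_le (h : IsLocal M S g V p B CE Λ r τ y w)
    (hτ : τ * (Λ * CE * B) ≤ 1 / 2) {x : X}
    (hx : CE * ‖x - w‖ + τ * (CE * B + Λ * CE * B) < r) :
    ‖quad S τ M.c M.b 1 (fun j => g (stage M S g τ x j)) -
      quad S τ M.c M.b 1 (fun j => g (stage M S g τ w j))‖ ≤ 2 * Λ * CE * B * CE * ‖x - w‖ := by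
  have hw : CE * ‖w - w‖ + τ * (CE * B + Λ * CE * B) < r := by
    rw [sub_self, norm_zero, mul_zero]
    linarith [mul_nonneg h.CE_nonneg (norm_nonneg (x - w))]
  have h0 := mul_nonneg h.CE_nonneg (norm_nonneg (x - w))
  have h1 := h.norm_sub_le_of_defect hτ h0 (h.stage_mem_ball hx) (h.stage_mem_ball hw) fun i => by
    nth_rewrite 1 [stage_eq M S g τ x i]
    nth_rewrite 1 [stage_eq M S g τ w i]
    rw [add_sub_cancel_right, add_sub_cancel_right, ← map_sub]
    exact ((S _).le_opNorm _).trans (mul_le_mul_of_nonneg_right (h.flow i) (norm_nonneg _))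
  refine (h.norm_quad_final_sub_le (mul_nonneg zero_le_two h0) (h.stage_mem_ball hx)
    (h.stage_mem_ball hw) h1).trans (le_of_eq ?_)
  ring

end IsLocal

/-! ### Accuracy of the Picard iterations -/

/-- Bounds of `expand`. -/
def expandBound (p : ℕ) (B CE Λ : ℝ) : ℕ → ℝ
  | 0 => 0
  | m + 1 => Λ * CE * ∑ k ∈ Finset.range p, ((k.factorial : ℝ)⁻¹) * (B * expandBound p B CE Λ m ^ k)

/-- Error constants of `expand`. -/
def expandError (p : ℕ) (B CE Λ : ℝ) : ℕ → ℝ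
  | 0 => Λ * CE * B
  | m + 1 => Λ * CE * (B * expandError p B CE Λ m + B * expandBound p B CE Λ m ^ p)

theorem expandBound_nonneg (p : ℕ) {B CE Λ : ℝ} (hB : 0 ≤ B) (hCE : 0 ≤ CE) (hΛ : 0 ≤ Λ) (m : ℕ) :
    0 ≤ expandBound p B CE Λ m := by
  induction m with
  | zero => exact le_rfl
  | succ m ih => rw [expandBound]; positivity

theorem expandError_nonneg (p : ℕ) {B CE Λ : ℝ} (hB : 0 ≤ B) (hCE : 0 ≤ CE) (hΛ : 0 ≤ Λ) (m : ℕ) :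
    0 ≤ expandError p B CE Λ m := by
  have := expandBound_nonneg p hB hCE hΛ
  induction m with
  | zero => rw [expandError]; positivity
  | succ m ih => rw [expandError]; have := this m; positivity

namespace IsLocal

variable {M : ExplicitRK s} {S : ℝ → X →L[ℝ] X} {g : X → X} {V : Set X} {p : ℕ}
    {B CE Λ r τ : ℝ} {y : Fin s → X} {w : X}

theorem flow_mem_ball (h : IsLocal M S g V p B CE Λ r τ y w) (hr : τ * (CE * B) < r) (i : Fin s) :
    S (M.c i * τ) w ∈ Metric.ball (y i) r :=
  mem_ball_iff_norm.2 ((h.near i).trans_lt hr)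

theorem norm_expand_le (h : IsLocal M S g V p B CE Λ r τ y w) (hr : τ * (CE * B) < r)
    (hτ : τ ≤ 1) (m : ℕ) {ρ : Fin s → ℝ} {ζ : ℝ} (hρ : RowBound S τ CE Λ M.c ρ ζ) :
    ‖expand p M S g τ w m ρ ζ‖ ≤ τ * expandBound p B CE Λ m := by
  have hβ := expandBound_nonneg p h.B_nonneg h.CE_nonneg h.Λ_nonneg
  have hB := h.B_nonneg
  have hτ0 := h.τ_nonneg
  induction m generalizing ρ ζ with
  | zero => simp [expand, expandBound]
  | succ m ih =>
    have hβm := hβ m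
    rw [expand, expandBound, norm_smul, Real.norm_eq_abs, abs_of_nonneg h.τ_nonneg]
    refine mul_le_mul_of_nonneg_left (hρ.norm_quad_le h.CE_nonneg (by positivity) fun j _ => ?_)
      h.τ_nonneg
    refine (norm_sum_le _ _).trans (Finset.sum_le_sum fun k hk => ?_)
    rw [norm_smul, Real.norm_eq_abs, abs_of_nonneg (by positivity)]
    refine mul_le_mul_of_nonneg_left ?_ (by positivity)
    refine (ContinuousMultilinearMap.le_opNorm _ _).trans ?_
    rw [Finset.prod_const, Finset.card_univ, Fintype.card_fin]
    refine mul_le_mul (h.deriv.bound k (Finset.mem_range.1 hk).le _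
      (h.ball j (h.flow_mem_ball hr j))) ?_ (by positivity) h.B_nonneg
    exact pow_le_pow_left₀ (norm_nonneg _)
      ((ih (h.rows j)).trans (mul_le_of_le_one_left hβm hτ)) _

/-- Each Picard iteration gains a factor `τ` through the Lipschitz continuity of `g`. Replacing `g`
by its Taylor polynomial costs the `p`-th power of an increment of size `O(τ)`. -/
theorem norm_quad_stage_sub_expand_le (h : IsLocal M S g V p B CE Λ r τ y w)
    (hr : τ * (CE * B + Λ * CE * B) < r) (hτ : τ ≤ 1) (m : ℕ) (hm : m ≤ p)
    (hβr : ∀ m < p, τ * (CE * B + expandBound p B CE Λ m) < r)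
    {ρ : Fin s → ℝ} {ζ : ℝ} (hρ : RowBound S τ CE Λ M.c ρ ζ) :
    ‖τ • quad S τ M.c ρ ζ (fun j => g (stage M S g τ w j)) - expand p M S g τ w m ρ ζ‖
      ≤ τ ^ (m + 1) * expandError p B CE Λ m := by
  have hβ := expandBound_nonneg p h.B_nonneg h.CE_nonneg h.Λ_nonneg
  have hγ := expandError_nonneg p h.B_nonneg h.CE_nonneg h.Λ_nonneg
  have hB := h.B_nonneg
  have hCE := h.CE_nonneg
  have hΛ := h.Λ_nonneg
  have hτ0 := h.τ_nonneg
  have hr' : τ * (CE * B) < r := by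
    have : 0 ≤ τ * (Λ * CE * B) := by positivity
    linarith
  have hst := h.stage_mem_ball (x := w) (by simpa using hr)
  induction m generalizing ρ ζ with
  | zero =>
    rw [expand, expandError, sub_zero, norm_smul, Real.norm_eq_abs, abs_of_nonneg h.τ_nonneg,
      zero_add, pow_one]
    exact mul_le_mul_of_nonneg_left (hρ.norm_quad_le h.CE_nonneg h.B_nonneg fun j _ =>
      h.deriv.norm_le (h.ball j (hst j))) h.τ_nonneg
  | succ m ih =>
    have hβm := hβ m
    have hγm := hγ m
    rw [expand, expandError, ← smul_sub, quad_sub, norm_smul, Real.norm_eq_abs,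
      abs_of_nonneg h.τ_nonneg]
    have key : ∀ j, ‖g (stage M S g τ w j) - ∑ k ∈ Finset.range p, ((k.factorial : ℝ)⁻¹) •
        iteratedFDeriv ℝ k g (S (M.c j * τ) w)
        (fun _ => expand p M S g τ w m (M.lower j) (M.c j))‖ ≤
        τ ^ (m + 1) * (B * expandError p B CE Λ m + B * expandBound p B CE Λ m ^ p) := by
      intro j
      have he := h.norm_expand_le hr' hτ m (h.rows j)
      have hmem : S (M.c j * τ) w + expand p M S g τ w m (M.lower j) (M.c j) ∈
          Metric.ball (y j) r := by
        rw [mem_ball_iff_norm, add_sub_right_comm]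
        refine (norm_add_le _ _).trans_lt (lt_of_le_of_lt (add_le_add (h.near j) he) ?_)
        rw [← mul_add]
        exact hβr m (by omega)
      have h1 := h.deriv.norm_sub_taylor_le h.isOpen (convex_ball _ _) (h.ball j)
        (h.flow_mem_ball hr' j) hmem
      have h2 := h.deriv.norm_sub_le h.isOpen h.one_le_p (convex_ball _ _) (h.ball j)
        (hst j) hmem
      have h3 := ih (by omega) (h.rows j)
      have h4 : stage M S g τ w j - (S (M.c j * τ) w + expand p M S g τ w m (M.lower j) (M.c j)) =
          τ • quad S τ M.c (M.lower j) (M.c j) (fun j => g (stage M S g τ w j)) -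
            expand p M S g τ w m (M.lower j) (M.c j) := by
        nth_rewrite 1 [stage_eq]
        abel
      rw [h4] at h2
      have h5 : ‖expand p M S g τ w m (M.lower j) (M.c j)‖ ^ p ≤
          τ ^ (m + 1) * expandBound p B CE Λ m ^ p := by
        refine (pow_le_pow_left₀ (norm_nonneg _) he p).trans ?_
        rw [mul_pow]
        -- The Taylor error `τ ^ p` suffices since `m + 1 ≤ p`; this is why `p` iterations are the
        -- useful maximum.
        exact mul_le_mul_of_nonneg_right (pow_le_pow_of_le_one hτ0 hτ hm) (by positivity)
      refine (norm_sub_le_norm_sub_add_norm_sub _ (g (S (M.c j * τ) w +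
        expand p M S g τ w m (M.lower j) (M.c j))) _).trans ?_
      have h6 := mul_le_mul_of_nonneg_left h3 hB
      have h7 := mul_le_mul_of_nonneg_left h5 hB
      linarith
    refine (mul_le_mul_of_nonneg_left (hρ.norm_quad_le h.CE_nonneg (by positivity)
      fun j _ => key j) h.τ_nonneg).trans (le_of_eq ?_)
    ring

theorem norm_treeQuad_le (h : IsLocal M S g V p B CE Λ r τ y w) (hr : τ * (CE * B) < r)
    {t : RTree} (ht : t.BranchingLT p) {ρ : Fin s → ℝ} {ζ : ℝ}
    (hρ : RowBound S τ CE Λ M.c ρ ζ) :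
    ‖treeQuad M S g τ w t ρ ζ‖ ≤ (Λ * CE * B) ^ t.order := by
  have hB := h.B_nonneg
  have hCE := h.CE_nonneg
  have hΛ := h.Λ_nonneg
  induction t generalizing ρ ζ with
  | node k child ih =>
    rw [treeQuad_node, order_node, pow_add, pow_one, mul_assoc _ B,
      ← Finset.prod_pow_eq_pow_sum]
    refine hρ.norm_quad_le hCE (by positivity) fun j _ => ?_
    refine (ContinuousMultilinearMap.le_opNorm _ _).trans ?_
    exact mul_le_mul (h.deriv.bound k ht.1.le _ (h.ball j (h.flow_mem_ball hr j)))
      (Finset.prod_le_prod (fun i _ => norm_nonneg _) fun i _ => ih i (ht.2 i) (h.rows j))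
      (Finset.prod_nonneg fun i _ => norm_nonneg _) hB

end IsLocal

end Lawson

namespace Lawson
open RTree

variable {s : ℕ} {X : Type*} [NormedAddCommGroup X] [NormedSpace ℝ X]

/-! ## Flows and mild solutions -/

theorem Setting.Ici_subset_times (m : Setting) : Ici 0 ⊆ m.times := by
  cases m with
  | group => exact subset_univ _
  | semigroup => exact Subset.rfl

/-- Strong continuity together with the uniform bound `CE` gives joint continuity in time and
argument. -/
theorem IsBoundedFlow.continuousOn_apply {m : Setting} {A : X →ₗ.[ℝ] X} {S : ℝ → X →L[ℝ] X}
    {CE : ℝ} (h : IsBoundedFlow m A S CE) {Y : Type*} [TopologicalSpace Y] {D : Set Y} {a : Y → ℝ}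
    {f : Y → X} (ha : ContinuousOn a D) (ha0 : ∀ y ∈ D, 0 ≤ a y) (hf : ContinuousOn f D) :
    ContinuousOn (fun y => S (a y) (f y)) D := by
  intro y₀ hy₀
  have h1 : Tendsto (fun y => S (a y) (f y₀)) (𝓝[D] y₀) (𝓝 (S (a y₀) (f y₀))) :=
    ((h.continuousOn (f y₀)).mono m.Ici_subset_times).comp ha ha0 y₀ hy₀
  have h2 : Tendsto (fun y => S (a y) (f y - f y₀)) (𝓝[D] y₀) (𝓝 0) := by
    have h3 : Tendsto (fun y => CE * ‖f y - f y₀‖) (𝓝[D] y₀) (𝓝 0) := by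
      have := ((hf y₀ hy₀).sub_const (f y₀)).norm.const_mul CE
      simpa using this
    refine squeeze_zero_norm' ?_ h3
    filter_upwards [self_mem_nhdsWithin] with y hy
    exact ((S _).le_opNorm _).trans (mul_le_mul_of_nonneg_right
      (h.bound _ (m.Ici_subset_times (ha0 y hy))) (norm_nonneg _))
  have h3 := h2.add h1
  simp only [map_sub, sub_add_cancel, zero_add] at h3
  exact h3

/-- The assumptions on the evolution equation. -/
structure IsProblem (m : Setting) (A : X →ₗ.[ℝ] X) (S : ℝ → X →L[ℝ] X) (g : X → X) (u : ℝ → X)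
    (p : ℕ) (CE B r K T τmax : ℝ) : Prop where
  flow : IsBoundedFlow m A S CE
  sol : IsSolution S g u T
  deriv : HasBoundedDerivs g (Metric.thickening r (u '' Icc 0 T)) p B
  regular : IsRegular m S g u T p τmax K
  one_le_p : 1 ≤ p
  r_pos : 0 < r
  CE_nonneg : 0 ≤ CE
  B_nonneg : 0 ≤ B
  K_nonneg : 0 ≤ K

namespace IsProblem

variable {m : Setting} {A : X →ₗ.[ℝ] X} {S : ℝ → X →L[ℝ] X} {g : X → X} {u : ℝ → X}
  {p : ℕ} {CE B r K T τmax : ℝ}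

theorem ball_subset (_ : IsProblem m A S g u p CE B r K T τmax) {t : ℝ} (ht : t ∈ Icc 0 T) :
    Metric.ball (u t) r ⊆ Metric.thickening r (u '' Icc 0 T) :=
  Metric.ball_subset_thickening (mem_image_of_mem u ht) r

theorem mem_thickening (h : IsProblem m A S g u p CE B r K T τmax) {t : ℝ} (ht : t ∈ Icc 0 T) :
    u t ∈ Metric.thickening r (u '' Icc 0 T) :=
  h.ball_subset ht (Metric.mem_ball_self h.r_pos)

theorem norm_flow_le (h : IsProblem m A S g u p CE B r K T τmax) {t : ℝ} (ht : 0 ≤ t) :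
    ‖S t‖ ≤ CE :=
  h.flow.bound t (m.Ici_subset_times ht)

theorem flow_add (h : IsProblem m A S g u p CE B r K T τmax) {a b : ℝ} (ha : 0 ≤ a) (hb : 0 ≤ b)
    (x : X) : S (a + b) x = S a (S b x) := by
  rw [h.flow.map_add a (m.Ici_subset_times ha) b (m.Ici_subset_times hb)]
  rfl

theorem continuousOn_g (h : IsProblem m A S g u p CE B r K T τmax) :
    ContinuousOn (fun t => g (u t)) (Icc 0 T) := by
  have h1 : ContinuousOn g (Metric.thickening r (u '' Icc 0 T)) := by
    have h2 := (h.deriv.differentiableOn 0 h.one_le_p).continuousOn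
    refine ((continuousMultilinearCurryFin0 ℝ X X).continuous.comp_continuousOn h2).congr
      fun x _ => ?_
    simp [iteratedFDeriv_zero_eq_comp]
  exact h1.comp h.sol.continuousOn fun t ht => h.mem_thickening ht

theorem continuousOn_integrand (h : IsProblem m A S g u p CE B r K T τmax) (t t₀ : ℝ) {D : Set ℝ}
    (hD : ∀ s ∈ D, s ≤ t ∧ t₀ + s ∈ Icc 0 T) :
    ContinuousOn (fun s => S (t - s) (g (u (t₀ + s)))) D :=
  h.flow.continuousOn_apply (by fun_prop) (fun s hs => sub_nonneg.2 (hD s hs).1)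
    (h.continuousOn_g.comp (by fun_prop) fun s hs => (hD s hs).2)

theorem rowBound (h : IsProblem m A S g u p CE B r K T τmax) {M : ExplicitRK s}
    (hc : m.NodesAdmissible M) {τ Λ ζ : ℝ} (hτ : 0 ≤ τ) {ρ : Fin s → ℝ}
    (hρ : ∑ j, |ρ j| ≤ Λ) (hζ : Monotone M.c → ∀ j, ρ j ≠ 0 → M.c j ≤ ζ) :
    RowBound S τ CE Λ M.c ρ ζ := by
  refine ⟨fun j hj => h.flow.bound _ ?_, hρ⟩
  cases m with
  | group => exact mem_univ _
  | semigroup => exact mul_nonneg (sub_nonneg.2 (hζ hc.2 j hj)) hτ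

variable [CompleteSpace X]

/-- Variation of constants restarted at `t₀`: the integral is split there, and the semigroup law
extracts `S τ` from the first part. -/
theorem eq_add_integral (h : IsProblem m A S g u p CE B r K T τmax) {t₀ τ : ℝ} (ht₀ : 0 ≤ t₀)
    (hτ : 0 ≤ τ) (hT : t₀ + τ ≤ T) :
    u (t₀ + τ) = S τ (u t₀) + ∫ s in (0 : ℝ)..τ, S (τ - s) (g (u (t₀ + s))) := by
  have hc : ContinuousOn (fun s => S (t₀ + τ - s) (g (u s))) (Icc 0 (t₀ + τ)) := by
    have := h.continuousOn_integrand (t₀ + τ) 0 (D := Icc 0 (t₀ + τ))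
      fun s hs => ⟨hs.2, by rw [zero_add]; exact ⟨hs.1, hs.2.trans hT⟩⟩
    simpa using this
  have hi1 : IntervalIntegrable (fun s => S (t₀ + τ - s) (g (u s))) MeasureTheory.volume 0 t₀ :=
    (hc.mono (by rw [uIcc_of_le ht₀]; exact Icc_subset_Icc_right (by linarith))).intervalIntegrable
  have hi2 : IntervalIntegrable (fun s => S (t₀ + τ - s) (g (u s))) MeasureTheory.volume t₀
      (t₀ + τ) :=
    (hc.mono (by
      rw [uIcc_of_le (by linarith)]; exact Icc_subset_Icc_left ht₀)).intervalIntegrable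
  have hi3 : IntervalIntegrable (fun s => S (t₀ - s) (g (u s))) MeasureTheory.volume 0 t₀ := by
    have := h.continuousOn_integrand t₀ 0 (D := uIcc 0 t₀) fun s hs => by
      rw [uIcc_of_le ht₀] at hs
      exact ⟨hs.2, by rw [zero_add]; exact ⟨hs.1, by linarith [hs.2]⟩⟩
    simpa using this.intervalIntegrable
  have h1 : ∫ s in (0 : ℝ)..t₀, S (t₀ + τ - s) (g (u s)) =
      S τ (∫ s in (0 : ℝ)..t₀, S (t₀ - s) (g (u s))) := by
    rw [← ContinuousLinearMap.intervalIntegral_comp_comm _ hi3]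
    refine intervalIntegral.integral_congr fun s hs => ?_
    rw [uIcc_of_le ht₀] at hs
    rw [← h.flow_add hτ (sub_nonneg.2 hs.2)]
    congr 2
    ring
  have h2 : ∫ s in t₀..(t₀ + τ), S (t₀ + τ - s) (g (u s)) =
      ∫ s in (0 : ℝ)..τ, S (τ - s) (g (u (t₀ + s))) := by
    have := intervalIntegral.integral_comp_add_left (a := 0) (b := τ)
      (fun s => S (t₀ + τ - s) (g (u s))) t₀
    rw [add_zero] at this
    rw [← this]
    refine intervalIntegral.integral_congr fun s _ => ?_
    congr 2
    ring
  rw [h.sol.eq (t₀ + τ) ⟨by linarith, hT⟩,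
    ← intervalIntegral.integral_add_adjacent_intervals hi1 hi2, h1, h2,
    h.sol.eq t₀ ⟨ht₀, by linarith⟩, map_add, add_comm t₀ τ, h.flow_add hτ ht₀, add_assoc]

theorem norm_flow_sub_le (h : IsProblem m A S g u p CE B r K T τmax) {t₀ τ : ℝ} (ht₀ : 0 ≤ t₀)
    (hτ : 0 ≤ τ) (hT : t₀ + τ ≤ T) : ‖S τ (u t₀) - u (t₀ + τ)‖ ≤ τ * (CE * B) := by
  rw [h.eq_add_integral ht₀ hτ hT, sub_add_cancel_left, norm_neg]
  refine (intervalIntegral.norm_integral_le_of_norm_le_const (C := CE * B) fun s hs => ?_).trans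
    (le_of_eq ?_)
  · rw [uIoc_of_le hτ] at hs
    refine ((S _).le_opNorm _).trans (mul_le_mul (h.norm_flow_le (sub_nonneg.2 hs.2))
      (h.deriv.norm_le (h.mem_thickening ⟨?_, ?_⟩)) (norm_nonneg _) h.CE_nonneg)
    · linarith [hs.1]
    · linarith [hs.2]
  · rw [sub_zero, abs_of_nonneg hτ, mul_comm]

theorem isLocal (h : IsProblem m A S g u p CE B r K T τmax) {M : ExplicitRK s}
    (hc : m.NodesAdmissible M) {t₀ τ Λ : ℝ} (ht₀ : 0 ≤ t₀) (hτ : 0 ≤ τ) (hT : t₀ + τ ≤ T)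
    (hΛ : 0 ≤ Λ) (hL : ∀ i, ∑ j, |M.lower i j| ≤ Λ) (hb : ∑ j, |M.b j| ≤ Λ) :
    IsLocal M S g (Metric.thickening r (u '' Icc 0 T)) p B CE Λ r τ
      (fun i => u (t₀ + M.c i * τ)) (u t₀) := by
  have h0 : ∀ i, 0 ≤ M.c i * τ := fun i => mul_nonneg (hc.1 i).1 hτ
  have h1 : ∀ i, M.c i * τ ≤ τ := fun i => mul_le_of_le_one_left hτ (hc.1 i).2
  have h2 : ∀ i, t₀ + M.c i * τ ≤ T := fun i => by linarith [h1 i]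
  refine ⟨fun i => h.rowBound hc hτ (hL i) fun hm j hj => hm (M.lt_of_lower_ne_zero hj).le,
    h.rowBound hc hτ hb fun _ j _ => (hc.1 j).2, fun i => h.norm_flow_le (h0 i),
    Metric.isOpen_thickening, h.deriv, fun i => h.ball_subset ⟨add_nonneg ht₀ (h0 i), h2 i⟩,
    fun i => (h.norm_flow_sub_le ht₀ (h0 i) (h2 i)).trans ?_,
    h.one_le_p, h.B_nonneg, h.CE_nonneg, hΛ, hτ⟩
  exact mul_le_mul_of_nonneg_right (h1 i) (mul_nonneg h.CE_nonneg h.B_nonneg)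

/-! ## Convergence of the Euler method with small steps -/

/-- The defect is the error of a Riemann sum. Its integrand depends on `i`, so propagation time and
evaluation time are separated: uniform continuity on a compact square yields one mesh for all `i`.
-/
theorem eventually_norm_euler_defect_le (h : IsProblem m A S g u p CE B r K T τmax) {t₀ τ : ℝ}
    (ht₀ : 0 ≤ t₀) (hτ : 0 < τ) (hT : t₀ + τ ≤ T) {ω : ℝ} (hω : 0 < ω) :
    ∀ᶠ N : ℕ in atTop, ∀ i ≤ N, ‖u (t₀ + i / N * τ) - S (i / N * τ) (u t₀) -
      τ • quad S τ (euler N).c (eulerRow N i) (i / N)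
        (fun j => g (u (t₀ + (euler N).c j * τ)))‖ ≤ τ * ω := by
  have hcomp : IsCompact (Icc (0 : ℝ) τ ×ˢ Icc (0 : ℝ) τ) := isCompact_Icc.prod isCompact_Icc
  have hcont : ContinuousOn (fun z : ℝ × ℝ => S z.1 (g (u (t₀ + z.2))))
      (Icc (0 : ℝ) τ ×ˢ Icc (0 : ℝ) τ) :=
    h.flow.continuousOn_apply continuousOn_fst (fun z hz => hz.1.1)
      (h.continuousOn_g.comp (by fun_prop) fun z hz =>
        ⟨add_nonneg ht₀ hz.2.1, by linarith [hz.2.2]⟩)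
  obtain ⟨δ, hδ, hunif⟩ := Metric.uniformContinuousOn_iff.1
    (hcomp.uniformContinuousOn_of_continuous hcont) ω hω
  have hlim : Tendsto (fun N : ℕ => τ / N) atTop (𝓝 0) := tendsto_const_div_atTop_nhds_zero_nat τ
  filter_upwards [eventually_gt_atTop 0, hlim.eventually_lt_const hδ] with N hN hNδ i hi
  have hN' : (0 : ℝ) < N := by exact_mod_cast hN
  set a : ℕ → ℝ := fun j => j / N * τ with ha
  have hmono : Monotone a := fun j k hjk => by
    simp only [ha]; gcongr
  have ha0 : a 0 = 0 := by simp [ha]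
  have haN : a N = τ := by simp [ha, hN'.ne']
  have hastep : ∀ j, a (j + 1) - a j = τ / N := fun j => by simp only [ha]; push_cast; ring
  have hai : 0 ≤ a i := ha0 ▸ hmono (Nat.zero_le i)
  have haiτ : a i ≤ τ := haN ▸ hmono hi
  set G : ℝ → X := fun s => S (a i - s) (g (u (t₀ + s))) with hG
  have hGc : ContinuousOn G (Icc 0 (a i)) := h.continuousOn_integrand (a i) t₀ fun s hs =>
    ⟨hs.2, add_nonneg ht₀ hs.1, by linarith [hs.2]⟩
  have hsub : ∀ j < i, Icc (a j) (a (j + 1)) ⊆ Icc 0 (a i) := fun j hj =>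
    Icc_subset_Icc (ha0 ▸ hmono (Nat.zero_le j)) (hmono hj)
  have hint : ∀ j < i, IntervalIntegrable G MeasureTheory.volume (a j) (a (j + 1)) := fun j hj =>
    (hGc.mono (by rw [uIcc_of_le (hmono (Nat.le_succ j))]; exact hsub j hj)).intervalIntegrable
  have hquad : τ • quad S τ (euler N).c (eulerRow N i) (i / N)
        (fun j => g (u (t₀ + (euler N).c j * τ))) =
      ∑ j ∈ Finset.range i, (τ / N) • G (a j) := by
    have := sum_eulerRow_mul hi (fun j => S ((i / N - j / N : ℝ) * τ)
      (g (u (t₀ + (j / N : ℝ) * τ))))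
    refine (congrArg (fun x => τ • x) this).trans ?_
    rw [smul_smul, Finset.smul_sum]
    refine Finset.sum_congr rfl fun j _ => ?_
    rw [hG, mul_one_div]
    simp only [ha, sub_mul]
  have hcell : ∀ j ∈ Finset.range i,
      ‖(∫ s in (a j)..(a (j + 1)), G s) - (τ / N) • G (a j)‖ ≤ τ / N * ω := by
    intro j hj
    have hj' := Finset.mem_range.1 hj
    have hle := hmono (Nat.le_succ j)
    have h1 : (∫ s in (a j)..(a (j + 1)), G s) - (τ / N) • G (a j) =
        ∫ s in (a j)..(a (j + 1)), (G s - G (a j)) := by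
      rw [intervalIntegral.integral_sub (hint j hj') intervalIntegrable_const,
        intervalIntegral.integral_const, hastep]
    rw [h1]
    refine (intervalIntegral.norm_integral_le_of_norm_le_const (C := ω) fun s hs => ?_).trans
      (le_of_eq ?_)
    · rw [uIoc_of_le hle] at hs
      have hs' := hsub j hj' (Ioc_subset_Icc_self hs)
      have hj'' := hsub j hj' (left_mem_Icc.2 hle)
      rw [← dist_eq_norm]
      refine (hunif (a i - s, s) ⟨⟨?_, ?_⟩, ⟨?_, ?_⟩⟩ (a i - a j, a j) ⟨⟨?_, ?_⟩, ⟨?_, ?_⟩⟩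
        ?_).le
      any_goals first | linarith [hs'.1, hs'.2, hj''.1, hj''.2]
      have h2 : |s - a j| < δ := by
        rw [abs_of_nonneg (by linarith [hs.1])]
        linarith [hs.2, hastep j]
      rw [Prod.dist_eq, Real.dist_eq, Real.dist_eq, max_lt_iff]
      refine ⟨?_, h2⟩
      rw [sub_sub_sub_cancel_left, abs_sub_comm]
      exact h2
    · rw [hastep, abs_of_nonneg (by positivity), mul_comm]
  have heq := h.eq_add_integral ht₀ hai (by linarith)
  have hsum := intervalIntegral.sum_integral_adjacent_intervals (a := a) (n := i) hint
  rw [ha0] at hsum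
  change ‖u (t₀ + a i) - S (a i) (u t₀) - _‖ ≤ _
  rw [heq, add_sub_cancel_left, hquad, ← hsum, ← Finset.sum_sub_distrib]
  refine (norm_sum_le_of_le _ hcell).trans ?_
  rw [Finset.sum_const, Finset.card_range, nsmul_eq_mul]
  calc i * (τ / N * ω) = a i * ω := by simp only [ha]; ring
    _ ≤ τ * ω := mul_le_mul_of_nonneg_right haiτ hω.le


end IsProblem

theorem Setting.nodesAdmissible_euler (m : Setting) (N : ℕ) : m.NodesAdmissible (euler N) := by
  refine ⟨euler_c_mem_Icc, ?_⟩
  cases m with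
  | group => trivial
  | semigroup =>
    intro i j hij
    exact div_le_div_of_nonneg_right (by exact_mod_cast hij) (Nat.cast_nonneg N)

theorem sum_abs_euler_lower_le {N : ℕ} (i : Fin N) : ∑ j, |(euler N).lower i j| ≤ 1 := by
  rw [euler_lower]
  exact sum_abs_eulerRow_le i.2.le

theorem sum_abs_euler_b_le (N : ℕ) : ∑ j, |(euler N).b j| ≤ 1 := by
  rw [euler_b]
  exact sum_abs_eulerRow_le le_rfl

namespace IsProblem

variable {m : Setting} {A : X →ₗ.[ℝ] X} {S : ℝ → X →L[ℝ] X} {g : X → X} {u : ℝ → X}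
  {p : ℕ} {CE B r K T τmax : ℝ} [CompleteSpace X]

theorem tendsto_step_euler (h : IsProblem m A S g u p CE B r K T τmax) {t₀ τ : ℝ}
    (ht₀ : 0 ≤ t₀) (hτ : 0 < τ) (hT : t₀ + τ ≤ T) (hτ2 : τ * (CE * B) ≤ 1 / 2)
    (hτr : τ * (CE * B + CE * B) < r) :
    Tendsto (fun N => step (euler N) S g τ (u t₀)) atTop (𝓝 (u (t₀ + τ))) := by
  rw [Metric.tendsto_atTop']
  intro ε hε
  -- A defect `τ * ω` in all stages leads to a final error of at most `Q * ω`.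
  set Q : ℝ := τ * (1 + CE * (B * (2 * τ))) with hQ
  have hCE := h.CE_nonneg
  have hB := h.B_nonneg
  have hQ0 : 0 < Q := by positivity
  obtain ⟨N₀, hN₀⟩ := eventually_atTop.1 ((eventually_gt_atTop 0).and
    (h.eventually_norm_euler_defect_le ht₀ hτ hT (ω := ε / (2 * Q)) (by positivity)))
  refine ⟨N₀, fun N hN => ?_⟩
  obtain ⟨hNpos, hdef⟩ := hN₀ N hN.le
  have hN' : (N : ℝ) ≠ 0 := by exact_mod_cast hNpos.ne'
  set ω := ε / (2 * Q) with hω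
  have hω0 : 0 < ω := by positivity
  have hloc := h.isLocal (m.nodesAdmissible_euler N) ht₀ hτ.le hT zero_le_one
    sum_abs_euler_lower_le (sum_abs_euler_b_le N)
  have hz : ∀ i, u (t₀ + (euler N).c i * τ) ∈ Metric.ball (u (t₀ + (euler N).c i * τ)) r :=
    fun i => Metric.mem_ball_self h.r_pos
  have hU := hloc.stage_mem_ball (x := u t₀) (by simpa using hτr)
  have h1 := hloc.norm_sub_le_of_defect (by simpa using hτ2) (δ := τ * ω) (by positivity) hz hU
    fun i => by
      nth_rewrite 1 [stage_eq]
      rw [add_sub_cancel_right, sub_right_comm, euler_lower]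
      exact hdef i i.2.le
  have h2 := hloc.norm_quad_final_sub_le (δ := 2 * (τ * ω)) (by positivity) hz hU h1
  have h3 := hdef N le_rfl
  rw [div_self hN', one_mul, ← euler_b] at h3
  rw [dist_comm, dist_eq_norm, step_eq]
  have h4 : u (t₀ + τ) - (S τ (u t₀) + τ • quad S τ (euler N).c (euler N).b 1
      fun j => g (stage (euler N) S g τ (u t₀) j)) =
      (u (t₀ + τ) - S τ (u t₀) - τ • quad S τ (euler N).c (euler N).b 1
        fun j => g (u (t₀ + (euler N).c j * τ))) +
      τ • ((quad S τ (euler N).c (euler N).b 1 fun j => g (u (t₀ + (euler N).c j * τ))) -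
        quad S τ (euler N).c (euler N).b 1 fun j => g (stage (euler N) S g τ (u t₀) j)) := by
    rw [smul_sub]; abel
  rw [h4]
  refine (norm_add_le _ _).trans_lt ?_
  rw [norm_smul, Real.norm_eq_abs, abs_of_pos hτ]
  calc _ ≤ τ * ω + τ * (1 * CE * (B * (2 * (τ * ω)))) :=
        add_le_add h3 (mul_le_mul_of_nonneg_left h2 hτ.le)
    _ = Q * ω := by rw [hQ]; ring
    _ = ε / 2 := by rw [hω]; field_simp
    _ < ε := half_lt_self hε

end IsProblem

end Lawson

namespace Lawson
open RTree

variable {s : ℕ}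

/-! ## The local error -/

theorem Setting.NodesAdmissible.mem_domain {m : Setting} {M : ExplicitRK s}
    (hc : m.NodesAdmissible M) (t : RTree) (a : t.Nodes → Fin s)
    (ha : weight M.lower t M.b a ≠ 0) : (fun v => M.c (a v)) ∈ m.domain t := by
  cases m with
  | group => exact fun v => hc.1 (a v)
  | semigroup =>
    exact isOrdered_of_weight_ne_zero (fun j => (hc.1 j).1)
      (fun i j hij => hc.2 (M.lt_of_lower_ne_zero hij).le) (fun j _ => (hc.1 j).2) ha

section

variable {X : Type*} [NormedAddCommGroup X] [NormedSpace ℝ X]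

theorem applyMoments_congr {N : Type*} [Fintype N] {q : ℕ}
    (A : (k : ℕ) → (N → ℝ) [×k]→L[ℝ] X) {μ ν : (N → ℕ) → ℝ}
    (h : ∀ d, ∑ v, d v ≤ q → μ d = ν d) : applyMoments q A μ = applyMoments q A ν := by
  refine Finset.sum_congr rfl fun k hk => ?_
  congr 1
  refine Finset.sum_congr rfl fun f _ => ?_
  rw [h _ (by rw [sum_exponents]; exact Finset.mem_range_succ_iff.1 hk)]

theorem tendsto_applyMoments {N ι : Type*} [Fintype N] {l : Filter ι} (q : ℕ)
    (A : (k : ℕ) → (N → ℝ) [×k]→L[ℝ] X) {μ : ι → (N → ℕ) → ℝ} {ν : (N → ℕ) → ℝ}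
    (h : ∀ d, Tendsto (fun i => μ i d) l (𝓝 (ν d))) :
    Tendsto (fun i => applyMoments q A (μ i)) l (𝓝 (applyMoments q A ν)) :=
  tendsto_finsetSum _ fun _ _ => (tendsto_finsetSum _ fun _ _ =>
    (h _).smul_const _).const_smul _

variable {m : Setting} {A : X →ₗ.[ℝ] X} {S : ℝ → X →L[ℝ] X} {g : X → X} {u : ℝ → X}
  {p : ℕ} {CE B r K T τmax : ℝ}

namespace IsProblem

theorem norm_treeQuad_sub_applyMoments_le (h : IsProblem m A S g u p CE B r K T τmax)
    {M : ExplicitRK s} (hc : m.NodesAdmissible M) {Λ : ℝ} (hL : ∀ i, ∑ j, |M.lower i j| ≤ Λ)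
    (hb : ∑ j, |M.b j| ≤ Λ) {t₀ τ : ℝ} (ht₀ : 0 ≤ t₀) (hτ : 0 < τ) (hT : t₀ + τ ≤ T)
    (hτm : τ ≤ τmax) {t : RTree} (ht : t.order ≤ p) :
    ‖treeQuad M S g τ (u t₀) t M.b 1 - applyMoments (p - t.order)
      (fun k => iteratedFDerivWithin ℝ k (integrand S g τ (u t₀) t 1) (m.domain t) 0)
      (fun d => moment M.lower M.c t d M.b)‖ ≤ Λ ^ t.order * (K * τ ^ (p - t.order + 1)) := by
  classical
  obtain ⟨hF, hLip⟩ := h.regular τ t₀ hτ hτm ht₀ hT t ht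
  have h0 : (0 : t.Nodes → ℝ) ∈ m.domain t :=
    m.mem_domain_of_isOrdered (t.isOrdered_zero zero_le_one)
  have hK := h.K_nonneg
  refine le_trans (le_of_eq ?_) (norm_sum_weight_sub_le m hL t hb (hc.mem_domain t) hF
    fun z hz => (hLip z hz 0 h0).trans (mul_le_of_le_one_right (by positivity) ?_))
  · congr 2
  · rw [sub_zero]
    refine (pi_norm_le_iff_of_nonneg zero_le_one).2 fun v => ?_
    have hv := Setting.mem_Icc_of_mem_domain hz v
    rw [Real.norm_eq_abs, abs_of_nonneg hv.1]
    exact hv.2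

/-- Both formulas are compared with the same Taylor polynomial, which costs one remainder each; `ε`
absorbs the distance of the Euler moments from the exact ones. -/
theorem eventually_norm_treeQuad_sub_euler_le (h : IsProblem m A S g u p CE B r K T τmax)
    {M : ExplicitRK s} (hM : M.HasOrder p) (hc : m.NodesAdmissible M) {Λ : ℝ} (hΛ : 1 ≤ Λ)
    (hL : ∀ i, ∑ j, |M.lower i j| ≤ Λ) (hb : ∑ j, |M.b j| ≤ Λ) {t₀ τ : ℝ} (ht₀ : 0 ≤ t₀)
    (hτ : 0 < τ) (hT : t₀ + τ ≤ T) (hτm : τ ≤ τmax) {t : RTree} (ht : t.order ≤ p) {ε : ℝ}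
    (hε : 0 < ε) :
    ∀ᶠ N : ℕ in atTop, ‖treeQuad M S g τ (u t₀) t M.b 1 -
      treeQuad (euler N) S g τ (u t₀) t (euler N).b 1‖ ≤
        2 * Λ ^ t.order * K * τ ^ (p - t.order + 1) + ε := by
  set D : (k : ℕ) → (t.Nodes → ℝ) [×k]→L[ℝ] X := fun k =>
    iteratedFDerivWithin ℝ k (integrand S g τ (u t₀) t 1) (m.domain t) 0 with hD
  have h1 := h.norm_treeQuad_sub_applyMoments_le hc hL hb ht₀ hτ hT hτm ht
  -- A degree of at most `p - order` is precisely the range of the order conditions.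
  rw [← hD, applyMoments_congr D (ν := exactMoment t) fun d hd =>
    hM.moment_eq t d (by omega)] at h1
  have hlim := tendsto_applyMoments (p - t.order) D (tendsto_euler_moment t)
  filter_upwards [(Metric.tendsto_nhds.1 hlim) ε hε] with N hN
  have h2 := h.norm_treeQuad_sub_applyMoments_le (m.nodesAdmissible_euler N)
    (fun i => (sum_abs_euler_lower_le i).trans hΛ) ((sum_abs_euler_b_le N).trans hΛ)
    ht₀ hτ hT hτm ht
  rw [← hD, norm_sub_rev] at h2
  rw [dist_comm, dist_eq_norm] at hN
  have h3 := norm_add₃_le.trans (add_le_add (add_le_add h1 hN.le) h2)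
  rw [sub_add_sub_cancel, sub_add_sub_cancel] at h3
  linarith

end IsProblem

end

/-- Error constants of the elementary integrals. -/
def treeError (B CE Λ K : ℝ) (t : RTree) : ℝ :=
  2 * Λ ^ t.order * K + 2 * (Λ * CE * B) ^ t.order

/-- Up to `p` nodes the powers `order` and `p - order + 1` of `τ` add up to `p + 1`. For larger
trees a crude bound of both formulas is enough; this is what the second summand of `treeError` is
for. -/
theorem eventually_pow_mul_norm_treeQuad_sub_euler_le {X : Type*} [NormedAddCommGroup X]
    [NormedSpace ℝ X] [CompleteSpace X] {m : Setting} {A : X →ₗ.[ℝ] X} {S : ℝ → X →L[ℝ] X}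
    {g : X → X} {u : ℝ → X} {p : ℕ} {CE B r K T τmax : ℝ}
    (h : IsProblem m A S g u p CE B r K T τmax)
    {M : ExplicitRK s} (hM : M.HasOrder p) (hc : m.NodesAdmissible M) {Λ : ℝ} (hΛ : 1 ≤ Λ)
    (hL : ∀ i, ∑ j, |M.lower i j| ≤ Λ) (hb : ∑ j, |M.b j| ≤ Λ) {t₀ τ : ℝ} (ht₀ : 0 ≤ t₀)
    (hτ : 0 < τ) (hτ1 : τ ≤ 1) (hT : t₀ + τ ≤ T) (hτm : τ ≤ τmax) (hr : τ * (CE * B) < r)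
    {t : RTree} (ht : t.BranchingLT p) {ε : ℝ} (hε : 0 < ε) :
    ∀ᶠ N : ℕ in atTop, τ ^ t.order * ‖treeQuad M S g τ (u t₀) t M.b 1 -
      treeQuad (euler N) S g τ (u t₀) t (euler N).b 1‖ ≤
        treeError B CE Λ K t * τ ^ (p + 1) + ε := by
  have hB := h.B_nonneg
  have hCE := h.CE_nonneg
  have hK := h.K_nonneg
  have hΛ0 : 0 ≤ Λ := zero_le_one.trans hΛ
  have hτp : τ ^ t.order ≤ 1 := pow_le_one₀ hτ.le hτ1
  by_cases hp : t.order ≤ p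
  · filter_upwards [h.eventually_norm_treeQuad_sub_euler_le hM hc hΛ hL hb ht₀ hτ hT hτm hp hε]
      with N hN
    have h1 : τ ^ t.order * τ ^ (p - t.order + 1) = τ ^ (p + 1) := by
      rw [← pow_add]; congr 1; omega
    calc _ ≤ τ ^ t.order * (2 * Λ ^ t.order * K * τ ^ (p - t.order + 1) + ε) :=
          mul_le_mul_of_nonneg_left hN (by positivity)
      _ = 2 * Λ ^ t.order * K * τ ^ (p + 1) + τ ^ t.order * ε := by rw [← h1]; ring
      _ ≤ treeError B CE Λ K t * τ ^ (p + 1) + ε := by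
        refine add_le_add (mul_le_mul_of_nonneg_right ?_ (by positivity))
          (mul_le_of_le_one_left hε.le hτp)
        unfold treeError
        exact le_add_of_nonneg_right (by positivity)
  · refine Eventually.of_forall fun N => ?_
    have hloc := h.isLocal hc ht₀ hτ.le hT hΛ0 hL hb
    have hloc' := h.isLocal (m.nodesAdmissible_euler N) ht₀ hτ.le hT hΛ0
      (fun i => (sum_abs_euler_lower_le i).trans hΛ) ((sum_abs_euler_b_le N).trans hΛ)
    have h1 := (norm_sub_le _ _).trans (add_le_add (hloc.norm_treeQuad_le hr ht hloc.final)
      (hloc'.norm_treeQuad_le hr ht hloc'.final))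
    have h2 : τ ^ t.order ≤ τ ^ (p + 1) := pow_le_pow_of_le_one hτ.le hτ1 (by omega)
    calc _ ≤ τ ^ (p + 1) * ((Λ * CE * B) ^ t.order + (Λ * CE * B) ^ t.order) :=
          mul_le_mul h2 h1 (norm_nonneg _) (by positivity)
      _ = 2 * (Λ * CE * B) ^ t.order * τ ^ (p + 1) := by ring
      _ ≤ treeError B CE Λ K t * τ ^ (p + 1) := by
        refine mul_le_mul_of_nonneg_right ?_ (by positivity)
        unfold treeError
        exact le_add_of_nonneg_left (by positivity)
      _ ≤ _ := le_add_of_nonneg_right hε.le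

universe u

theorem exists_norm_local_error_le {p : ℕ} {M : ExplicitRK s} (hM : M.HasOrder p) {m : Setting}
    (hc : m.NodesAdmissible M) {Λ : ℝ} (hΛ : 1 ≤ Λ) (hL : ∀ i, ∑ j, |M.lower i j| ≤ Λ)
    (hb : ∑ j, |M.b j| ≤ Λ) (CE B r K T τmax : ℝ) (hCE : 0 ≤ CE) (hB : 0 ≤ B) (hK : 0 ≤ K) :
    ∃ C : ℝ, 0 ≤ C ∧ ∀ (X : Type u) [NormedAddCommGroup X] [NormedSpace ℝ X] [CompleteSpace X]
      (A : X →ₗ.[ℝ] X) (S : ℝ → X →L[ℝ] X) (g : X → X) (u : ℝ → X),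
      IsProblem m A S g u p CE B r K T τmax → ∀ t₀ τ : ℝ, 0 ≤ t₀ → 0 < τ → τ ≤ 1 → τ ≤ τmax →
        t₀ + τ ≤ T → τ * (Λ * CE * B) ≤ 1 / 2 →
        τ * (CE * B + Λ * CE * B + ∑ k ∈ Finset.range p, expandBound p B CE Λ k) < r →
        ‖u (t₀ + τ) - step M S g τ (u t₀)‖ ≤ C * τ ^ (p + 1) := by
  obtain ⟨ι, _, tr, α, hbr, hexp⟩ := exists_expand_eq_sum_treeQuad.{u} p p
  have hΛ0 : 0 ≤ Λ := zero_le_one.trans hΛ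
  have hγ := expandError_nonneg p hB hCE hΛ0 p
  have hβ := expandBound_nonneg p hB hCE hΛ0
  -- The truncation error of the expansion occurs twice, for `M` and for the Euler method; the rest
  -- compares the trees.
  refine ⟨2 * expandError p B CE Λ p + ∑ i, |α i| * treeError B CE Λ K (tr i), ?_, ?_⟩
  · unfold treeError
    positivity
  intro X _ _ _ A S g u h t₀ τ ht₀ hτ hτ1 hτm hT hτ2 hτr
  have hΛCE : CE * B ≤ Λ * CE * B := by
    rw [mul_assoc]; exact le_mul_of_one_le_left (by positivity) hΛ
  have hCEB : 0 ≤ CE * B := by positivity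
  have hβsum : 0 ≤ ∑ k ∈ Finset.range p, expandBound p B CE Λ k :=
    Finset.sum_nonneg fun k _ => hβ k
  have hbase : ∀ x : ℝ, x ≤ CE * B + Λ * CE * B + ∑ k ∈ Finset.range p, expandBound p B CE Λ k →
      τ * x < r := fun x hx => (mul_le_mul_of_nonneg_left hx hτ.le).trans_lt hτr
  have hr1 : τ * (CE * B) < r := hbase _ (by linarith)
  have hr2 : τ * (CE * B + Λ * CE * B) < r := hbase _ (by linarith)
  have hr3 : ∀ k < p, τ * (CE * B + expandBound p B CE Λ k) < r := fun k hk => hbase _ (by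
    have := Finset.single_le_sum (f := expandBound p B CE Λ) (fun k _ => hβ k)
      (Finset.mem_range.2 hk)
    linarith)
  have hloc := h.isLocal hc ht₀ hτ.le hT hΛ0 hL hb
  have hlocE : ∀ N : ℕ, _ := fun N => h.isLocal (m.nodesAdmissible_euler N) ht₀ hτ.le hT hΛ0
      (fun i => (sum_abs_euler_lower_le i).trans hΛ) ((sum_abs_euler_b_le N).trans hΛ)
  have hlim := h.tendsto_step_euler ht₀ hτ hT
    ((mul_le_mul_of_nonneg_left hΛCE hτ.le).trans hτ2) (hbase _ (by linarith))
  have hlim2 : Tendsto (fun N => ‖step (euler N) S g τ (u t₀) - step M S g τ (u t₀)‖) atTop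
      (𝓝 ‖u (t₀ + τ) - step M S g τ (u t₀)‖) := (hlim.sub_const _).norm
  refine le_of_forall_pos_le_add fun ε hε => ?_
  set η : ℝ := ε / (∑ i, |α i| + 1) with hη
  have hα : 0 < ∑ i, |α i| + 1 := by positivity
  have hη0 : 0 < η := by positivity
  -- The bound is free of `N`, so it passes from the Euler steps to the exact solution.
  refine le_of_tendsto hlim2 ?_
  have hev : ∀ᶠ N : ℕ in atTop, ∀ i, τ ^ (tr i).order * ‖treeQuad M S g τ (u t₀) (tr i) M.b 1 -
      treeQuad (euler N) S g τ (u t₀) (tr i) (euler N).b 1‖ ≤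
        treeError B CE Λ K (tr i) * τ ^ (p + 1) + η :=
    eventually_all.2 fun i => eventually_pow_mul_norm_treeQuad_sub_euler_le h hM hc hΛ hL hb
      ht₀ hτ hτ1 hT hτm hr1 (hbr i) hη0
  filter_upwards [hev] with N hN
  have h1 := hloc.norm_quad_stage_sub_expand_le hr2 hτ1 p le_rfl hr3 hloc.final
  have h2 := (hlocE N).norm_quad_stage_sub_expand_le hr2 hτ1 p le_rfl hr3 (hlocE N).final
  have h3 : ‖expand p (euler N) S g τ (u t₀) p (euler N).b 1 -
      expand p M S g τ (u t₀) p M.b 1‖ ≤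
      (∑ i, |α i| * treeError B CE Λ K (tr i)) * τ ^ (p + 1) + ε := by
    rw [hexp, hexp, ← Finset.sum_sub_distrib]
    have h4 : ∀ i ∈ Finset.univ, ‖(α i * τ ^ (tr i).order) •
          treeQuad (euler N) S g τ (u t₀) (tr i) (euler N).b 1 -
        (α i * τ ^ (tr i).order) • treeQuad M S g τ (u t₀) (tr i) M.b 1‖ ≤
        |α i| * (treeError B CE Λ K (tr i) * τ ^ (p + 1) + η) := by
      intro i _
      rw [← smul_sub, norm_smul, Real.norm_eq_abs, abs_mul, abs_of_pos (pow_pos hτ _), mul_assoc,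
        norm_sub_rev]
      exact mul_le_mul_of_nonneg_left (hN i) (abs_nonneg _)
    refine (norm_sum_le_of_le _ h4).trans ?_
    simp only [mul_add, Finset.sum_add_distrib, ← Finset.sum_mul, ← mul_assoc]
    refine add_le_add le_rfl ?_
    rw [hη, mul_div_assoc', div_le_iff₀ hα]
    nlinarith
  rw [norm_sub_rev] at h1
  have h5 := norm_add₃_le.trans (add_le_add (add_le_add h2 h3) h1)
  rw [sub_add_sub_cancel, sub_add_sub_cancel] at h5
  rw [step_eq, step_eq, add_sub_add_left_eq_sub]
  refine h5.trans (le_of_eq ?_)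
  ring

/-! ## The global error -/

/-- The error after `n + 1` steps, propagated over `k` steps, contains the error after `n` steps
propagated over `k + 1` steps. A claim for all `k` therefore closes the induction, with a factor
`CE` only on the newly added terms. Hypothesis `hsmall` keeps the stages where `g` is controlled. -/
theorem IsProblem.norm_flow_global_error_le {X : Type*} [NormedAddCommGroup X]
    [NormedSpace ℝ X] [CompleteSpace X] {m : Setting} {A : X →ₗ.[ℝ] X} {S : ℝ → X →L[ℝ] X}
    {g : X → X} {u : ℝ → X} {p : ℕ} {CE B r K T τmax : ℝ}
    (h : IsProblem m A S g u p CE B r K T τmax) {M : ExplicitRK s} (hc : m.NodesAdmissible M)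
    {Λ : ℝ} (hΛ : 0 ≤ Λ) (hL : ∀ i, ∑ j, |M.lower i j| ≤ Λ) (hb : ∑ j, |M.b j| ≤ Λ)
    {τ δ a : ℝ} (hτ : 0 < τ) (hτ2 : τ * (Λ * CE * B) ≤ 1 / 2) (hδ0 : 0 ≤ δ)
    (hδ : ∀ t₀, 0 ≤ t₀ → t₀ + τ ≤ T → ‖u (t₀ + τ) - step M S g τ (u t₀)‖ ≤ δ)
    (ha : a = CE * (2 * Λ * CE * B * CE))
    (hsmall : ∀ n : ℕ, n * τ ≤ T →
      CE * (n * (CE * δ) * Real.exp (a * (n * τ))) + τ * (CE * B + Λ * CE * B) < r)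
    (n : ℕ) (hn : n * τ ≤ T) (k : ℕ) :
    ‖S (k * τ) (u (n * τ) - numSol M S g τ (u 0) n)‖ ≤
      n * (CE * δ) * Real.exp (a * (n * τ)) := by
  have hCE := h.CE_nonneg
  have hB := h.B_nonneg
  have ha0 : 0 ≤ a := by rw [ha]; positivity
  induction n generalizing k with
  | zero => simp [numSol]
  | succ n ih =>
    have hn1 : n * τ + τ = (n + 1 : ℕ) * τ := by push_cast; ring
    have hnT : n * τ + τ ≤ T := hn1 ▸ hn
    have hn0 : (0 : ℝ) ≤ n * τ := by positivity
    have ih' := ih (by linarith)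
    set w := u (n * τ) with hw
    set x := numSol M S g τ (u 0) n with hx
    set E := n * (CE * δ) * Real.exp (a * (n * τ)) with hE
    have he : ‖x - w‖ ≤ E := by
      have := ih' 0
      rwa [Nat.cast_zero, zero_mul, h.flow.map_zero, ContinuousLinearMap.id_apply,
        norm_sub_rev] at this
    have hloc := h.isLocal hc hn0 hτ.le hnT hΛ hL hb
    have hq := hloc.norm_quad_stage_sub_le hτ2 (x := x) (by
      refine lt_of_le_of_lt ?_ (hsmall n (by linarith))
      exact add_le_add_left (mul_le_mul_of_nonneg_left he hCE) _)
    rw [norm_sub_rev] at hq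
    have hk : (k : ℝ) * τ + τ = (k + 1 : ℕ) * τ := by push_cast; ring
    have hkτ : (0 : ℝ) ≤ k * τ := by positivity
    have hdec : S (k * τ) (u ((n + 1 : ℕ) * τ) - numSol M S g τ (u 0) (n + 1)) =
        S ((k + 1 : ℕ) * τ) (w - x) + S (k * τ) ((u (n * τ + τ) - step M S g τ w) +
          τ • (quad S τ M.c M.b 1 (fun j => g (stage M S g τ w j)) -
            quad S τ M.c M.b 1 (fun j => g (stage M S g τ x j)))) := by
      rw [← hk, h.flow_add hkτ hτ.le, ← map_add, ← hn1, numSol, ← hx, step_eq, step_eq,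
        map_sub (S τ) w x, smul_sub]
      congr 1
      abel
    have hbound : ‖S (k * τ) ((u (n * τ + τ) - step M S g τ w) +
          τ • (quad S τ M.c M.b 1 (fun j => g (stage M S g τ w j)) -
            quad S τ M.c M.b 1 (fun j => g (stage M S g τ x j))))‖ ≤
        CE * (δ + τ * (2 * Λ * CE * B * CE * E)) := by
      refine ((S _).le_opNorm _).trans (mul_le_mul (h.norm_flow_le hkτ) ?_ (norm_nonneg _) hCE)
      refine (norm_add_le _ _).trans (add_le_add (hδ _ hn0 hnT) ?_)
      rw [norm_smul, Real.norm_eq_abs, abs_of_pos hτ]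
      exact mul_le_mul_of_nonneg_left
        (hq.trans (mul_le_mul_of_nonneg_left he (by positivity))) hτ.le
    rw [hdec]
    refine (norm_add_le _ _).trans ((add_le_add (ih' (k + 1)) hbound).trans ?_)
    have hexp : Real.exp (a * (n * τ)) * (1 + a * τ) ≤ Real.exp (a * ((n + 1 : ℕ) * τ)) := by
      rw [← hn1, mul_add a, Real.exp_add]
      exact mul_le_mul_of_nonneg_left (by linarith [Real.add_one_le_exp (a * τ)])
        (Real.exp_pos _).le
    have hexp1 : 1 ≤ Real.exp (a * ((n + 1 : ℕ) * τ)) := Real.one_le_exp (by positivity)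
    calc E + CE * (δ + τ * (2 * Λ * CE * B * CE * E))
        = n * (CE * δ) * (Real.exp (a * (n * τ)) * (1 + a * τ)) + CE * δ * 1 := by
          rw [hE, ha]; ring
      _ ≤ n * (CE * δ) * Real.exp (a * ((n + 1 : ℕ) * τ)) +
          CE * δ * Real.exp (a * ((n + 1 : ℕ) * τ)) := by gcongr
      _ = _ := by push_cast; ring

end Lawson

end

/-! ### Choice of the constants -/

theorem mainTheorem1 {s p : ℕ} (hp : 1 ≤ p) (M : Lawson.ExplicitRK s) (hM : M.HasOrder p)
    (m : Lawson.Setting) (hc : m.NodesAdmissible M)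
    (CE B r K T τmax : ℝ) (hr : 0 < r) (hτmax : 0 < τmax) :
    ∃ C τ₀ : ℝ, 0 < τ₀ ∧
      ∀ (X : Type*) [NormedAddCommGroup X] [NormedSpace ℝ X] [CompleteSpace X]
        (A : X →ₗ.[ℝ] X) (S : ℝ → X →L[ℝ] X) (g : X → X) (u : ℝ → X),
        Lawson.IsBoundedFlow m A S CE →
        Lawson.IsSolution S g u T →
        Lawson.HasBoundedDerivs g (Metric.thickening r (u '' Set.Icc 0 T)) p B →
        Lawson.IsRegular m S g u T p τmax K →
        ∀ (τ : ℝ) (n : ℕ), 0 < τ → τ ≤ τ₀ → n * τ ≤ T →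
          ‖u (n * τ) - Lawson.numSol M S g τ (u 0) n‖ ≤ C * τ ^ p := by
  -- The given bounds carry no sign; enlarging them to nonnegative ones preserves the hypotheses.
  obtain ⟨CE', hCE'⟩ : ∃ x, x = max CE 0 := ⟨_, rfl⟩
  obtain ⟨B', hB'⟩ : ∃ x, x = max B 0 := ⟨_, rfl⟩
  obtain ⟨K', hK'⟩ : ∃ x, x = max K 0 := ⟨_, rfl⟩
  have hCE : 0 ≤ CE' := hCE' ▸ le_max_right _ _
  have hB : 0 ≤ B' := hB' ▸ le_max_right _ _
  have hK : 0 ≤ K' := hK' ▸ le_max_right _ _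
  -- The summand one makes `Λ` a bound for the weights of the Euler methods too.
  set Λ : ℝ := 1 + ∑ j, |M.b j| + ∑ i, ∑ j, |M.lower i j| with hΛdef
  have hb0 : 0 ≤ ∑ j, |M.b j| := Finset.sum_nonneg fun _ _ => abs_nonneg _
  have hL0 : ∀ i, 0 ≤ ∑ j, |M.lower i j| := fun i => Finset.sum_nonneg fun _ _ => abs_nonneg _
  have hL1 : 0 ≤ ∑ i, ∑ j, |M.lower i j| := Finset.sum_nonneg fun i _ => hL0 i
  have hΛ : 1 ≤ Λ := by linarith
  have hΛ0 : 0 ≤ Λ := zero_le_one.trans hΛ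
  have hb : ∑ j, |M.b j| ≤ Λ := by linarith
  have hL : ∀ i, ∑ j, |M.lower i j| ≤ Λ := fun i => by
    have := Finset.single_le_sum (fun i _ => hL0 i) (Finset.mem_univ i)
    linarith
  obtain ⟨C, hC0, hC⟩ := Lawson.exists_norm_local_error_le hM hc hΛ hL hb CE' B' r K' T τmax
    hCE hB hK
  have hβ := Lawson.expandBound_nonneg p hB hCE hΛ0
  obtain ⟨Q, hQ⟩ : ∃ Q, Q = CE' * B' + Λ * CE' * B' +
    ∑ k ∈ Finset.range p, Lawson.expandBound p B' CE' Λ k := ⟨_, rfl⟩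
  have hβ0 : 0 ≤ ∑ k ∈ Finset.range p, Lawson.expandBound p B' CE' Λ k :=
    Finset.sum_nonneg fun k _ => hβ k
  have hCEB : 0 ≤ CE' * B' := by positivity
  have hΛCEB : 0 ≤ Λ * CE' * B' := by positivity
  have hQ0 : 0 ≤ Q := by linarith
  obtain ⟨a, ha⟩ : ∃ a, a = CE' * (2 * Λ * CE' * B' * CE') := ⟨_, rfl⟩
  have ha0 : 0 ≤ a := by rw [ha]; positivity
  obtain ⟨C', hC'⟩ : ∃ C', C' = |T| * (CE' * C) * Real.exp (a * |T|) := ⟨_, rfl⟩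
  have hC'0 : 0 ≤ C' := by rw [hC']; positivity
  -- The third bound gives `τ * Q ≤ 1 / 2`, as needed for stability; the fourth gives `τ * (Q + CE'
  -- * C') < r`, which keeps the stages within distance `r` of the solution.
  refine ⟨C', min (min 1 τmax) (min (1 / (2 * (Q + 1))) (r / (4 * (Q + 1 + CE' * C')))),
    by positivity, ?_⟩
  intro X _ _ _ A S g u hflow hsol hderiv hreg τ n hτ hτ₀ hn
  have hτ1 : τ ≤ 1 := hτ₀.trans ((min_le_left _ _).trans (min_le_left _ _))
  have hτm : τ ≤ τmax := hτ₀.trans ((min_le_left _ _).trans (min_le_right _ _))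
  have hτ2 : τ * (2 * (Q + 1)) ≤ 1 := (le_div_iff₀ (by positivity)).1
    (hτ₀.trans ((min_le_right _ _).trans (min_le_left _ _)))
  have hτ3 : τ * (4 * (Q + 1 + CE' * C')) ≤ r := (le_div_iff₀ (by positivity)).1
    (hτ₀.trans ((min_le_right _ _).trans (min_le_right _ _)))
  have hτQ : 0 ≤ τ * Q := by positivity
  have hτC : 0 ≤ τ * (CE' * C') := by positivity
  have hprob : Lawson.IsProblem m A S g u p CE' B' r K' T τmax := by
    refine ⟨⟨hflow.map_zero, hflow.map_add, hflow.continuousOn, hflow.generator, fun t ht =>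
      (hflow.bound t ht).trans (hCE' ▸ le_max_left _ _)⟩, hsol,
      ⟨hderiv.differentiableOn, fun k hk x hx =>
        (hderiv.bound k hk x hx).trans (hB' ▸ le_max_left _ _)⟩, ?_, hp, hr, hCE, hB, hK⟩
    intro τ t₀ hτ hτm ht₀ hT t ht
    obtain ⟨h1, h2⟩ := hreg τ t₀ hτ hτm ht₀ hT t ht
    refine ⟨h1, fun σ hσ σ' hσ' => (h2 σ hσ σ' hσ').trans ?_⟩
    gcongr
    exact hK' ▸ le_max_left _ _
  have hE : ∀ n : ℕ, n * τ ≤ T →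
      n * (CE' * (C * τ ^ (p + 1))) * Real.exp (a * (n * τ)) ≤ C' * τ ^ p := by
    intro n hn
    have hT : n * τ ≤ |T| := hn.trans (le_abs_self T)
    calc n * (CE' * (C * τ ^ (p + 1))) * Real.exp (a * (n * τ))
        = (n * τ) * (CE' * C) * Real.exp (a * (n * τ)) * τ ^ p := by ring
      _ ≤ |T| * (CE' * C) * Real.exp (a * |T|) * τ ^ p := by gcongr
      _ = C' * τ ^ p := by rw [hC']
  have hτp : τ ^ p ≤ τ := by simpa using pow_le_pow_of_le_one hτ.le hτ1 hp
  have key := hprob.norm_flow_global_error_le hc hΛ0 hL hb hτ (δ := C * τ ^ (p + 1)) (a := a)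
    (by nlinarith) (by positivity)
    (fun t₀ ht₀ hT => hC X A S g u hprob t₀ τ ht₀ hτ hτ1 hτm hT (by nlinarith)
      (by rw [← hQ]; nlinarith)) ha
    (fun n hn => by
      have h1 : CE' * (n * (CE' * (C * τ ^ (p + 1))) * Real.exp (a * (n * τ))) ≤
          CE' * (C' * τ) := mul_le_mul_of_nonneg_left ((hE n hn).trans (by gcongr)) hCE
      have h2 : τ * (CE' * B' + Λ * CE' * B') ≤ τ * Q := by
        refine mul_le_mul_of_nonneg_left ?_ hτ.le
        linarith
      nlinarith) n hn 0
  -- The case `k = 0`, in which the propagated error is the error itself.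
  rw [Nat.cast_zero, zero_mul, hflow.map_zero, ContinuousLinearMap.id_apply] at key
  exact key.trans (hE n hn)
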